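/- Setting. Let $\mathcal K$ be a finite-dimensional complex Hilbert space, $\mathcal H_{\mathrm R}$ a complex Hilbert space, $K$ a self-adjoint operator on $\mathcal K$, $H_{\mathrm R}$ a (possibly unbounded) self-adjoint operator on $\mathcal H_{\mathrm R}$, given by its spectral measure, and $V\in B(\mathcal K,\mathcal K\otimes\mathcal H_{\mathrm R})$. Let $\beta>0$ and assume $\operatorname{Tr}e^{-\beta K}=1$. On the finite-particle vectors of $\mathcal K\otimes\Gamma_{\mathrm s}(\mathcal H_{\mathrm R})$, where $\Gamma_{\mathrm s}(\mathcal H_{\mathrm R})=\bigoplus_{n\ge 0}\otimes_{\mathrm s}^n\mathcal H_{\mathrm R}$ is the bosonic Fock space with vacuum $\Omega$, let $a(V)\Psi=\sqrt n\,(V^*\otimes 1^{\otimes(n-1)})\Psi$ for $\Psi\in\mathcal K\otimes\otimes_{\mathrm s}^n\mathcal H_{\mathrm R}$, let $a^*(V)$ be the adjoint of $a(V)$, and let $$e^{itH_0}=e^{itK}\otimes\Gamma(e^{itH_{\mathrm R}}),\qquad H_0=K\otimes1+1\otimes d\Gamma(H_{\mathrm R}),$$ $$\tau_t(C)=e^{itH_0}Ce^{-itH_0},\qquad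 \omega_\beta(C)=\operatorname{Tr}\big((e^{-\beta K}\otimes|\Omega)(\Omega|)\,C\big).$$ Theorem. The following two conditions are equivalent. 1. (KMS identity) For all $D_1,D_2,D_1',D_2'\in B(\mathcal K)$, with $$B_j=(D_j\otimes1)\,(a^*(V)+a(V))\,(D_j'\otimes1),\qquad j=1,2,$$ and for all $t\in\mathbb R$, $$\omega_\beta(\tau_t(B_1)B_2)=\omega_\beta(B_2\,\tau_{t+i\beta}(B_1)).$$ Here the right-hand side denotes the value at $t+i\beta$ of the analytic continuation of $s\mapsto\omega_\beta(B_2\tau_s(B_1))$, $s\in\mathbb R$, to the strip $0\le\operatorname{Im}z\le\beta$ (a function bounded and continuous on the closed strip and holomorphic in its interior), and the existence of this continuation is part of the condition. 2. For every bounded Borel function $f:\mathbb R\to\mathbb C$ and every $A\in B(\mathcal K)$, $$\operatorname{Tr}_{\mathcal H_{\mathrm R}}\big((1\otimes f(-H_{\mathrm R}))\,V A V^*\big)=V^*\,\big(A\otimes e^{-\beta H_{\mathrm R}}f(H_{\mathrm R})\big)\,V .$$ Here $\operatorname{Tr}_{\mathcal H_{\mathrm R}}$ is the partial trace, and the right-hand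 side is $\lim_{n\to\infty}V^*\big(A\otimes 1_{[-n,n]}(H_{\mathrm R})e^{-\beta H_{\mathrm R}}f(H_{\mathrm R})\big)V$, the existence of the limit being part of the condition. The reservoir is called thermal at inverse temperature $\beta$ if these conditions hold. -/

import Mathlib

open scoped TensorProduct InnerProductSpace DirectSum InnerProduct

attribute [-instance] CStarModule.toInner

noncomputable section

namespace PauliFierz

/-! ## Self-adjoint operators through their spectral resolution -/

/-- A projection-valued measure on the Borel sets of `ℝ`, that is, the spectral resolution of a
(possibly unbounded) self-adjoint operator `H = ∫ x dE(x)` on the Hilbert space `𝓗`. By the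
spectral theorem `H ↔ E` is a bijection, and every function of `H` is defined through `E`. -/
structure SpectralResolution (𝓗 : Type*) [NormedAddCommGroup 𝓗] [InnerProductSpace ℂ 𝓗]
    [CompleteSpace 𝓗] where
  /-- the spectral projection `1_S(H)` -/
  proj : Set ℝ → 𝓗 →L[ℂ] 𝓗
  isStarProjection_proj : ∀ S, MeasurableSet S → IsStarProjection (proj S)
  proj_univ : proj Set.univ = 1
  hasSum_proj : ∀ S : ℕ → Set ℝ, (∀ n, MeasurableSet (S n)) →
    Pairwise (Function.onFun Disjoint S) →
    ∀ v, HasSum (fun n => proj (S n) v) (proj (⋃ n, S n) v)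

namespace SpectralResolution

variable {𝓗 : Type*} [NormedAddCommGroup 𝓗] [InnerProductSpace ℂ 𝓗] [CompleteSpace 𝓗]
  (E : SpectralResolution 𝓗)

theorem proj_empty : E.proj ∅ = 0 := by
  ext v
  have h := E.hasSum_proj (fun _ => ∅) (fun _ => MeasurableSet.empty)
    (fun _ _ _ => by simp [Function.onFun]) v
  have h2 := h.summable
  rw [summable_const_iff] at h2
  simpa using h2

theorem inner_proj (S : Set ℝ) (hS : MeasurableSet S) (v : 𝓗) :
    (⟪v, E.proj S v⟫_ℂ).re = ‖E.proj S v‖ ^ 2 := by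
  have h := E.isStarProjection_proj S hS
  have h1 : E.proj S (E.proj S v) = E.proj S v := by
    have := h.isIdempotentElem
    exact congrArg (fun T : 𝓗 →L[ℂ] 𝓗 => T v) this
  have h2 : ⟪E.proj S v, E.proj S v⟫_ℂ = ⟪v, E.proj S v⟫_ℂ := by
    have hs := h.isSelfAdjoint
    rw [ContinuousLinearMap.isSelfAdjoint_iff_isSymmetric] at hs
    have := hs v (E.proj S v)
    simp only [ContinuousLinearMap.coe_coe] at this
    rw [this, h1]
  rw [← h2, ← inner_self_eq_norm_sq (𝕜 := ℂ)]
  rfl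

/-- The scalar spectral measure `μ_v(S) = ‖E(S) v‖² = (v | E(S) v)` of a vector `v`. -/
def measure (v : 𝓗) : MeasureTheory.Measure ℝ :=
  MeasureTheory.Measure.ofMeasurable (fun S _ => ENNReal.ofReal (‖E.proj S v‖ ^ 2))
    (by simp [E.proj_empty])
    (by
      intro S hS hd
      have h := (E.hasSum_proj S hS hd v)
      have h1 : HasSum (fun n => (⟪v, E.proj (S n) v⟫_ℂ).re) (⟪v, E.proj (⋃ n, S n) v⟫_ℂ).re :=
        Complex.hasSum_re (h.mapL (innerSL ℂ v))
      rw [E.inner_proj _ (MeasurableSet.iUnion hS)] at h1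
      simp_rw [fun n => E.inner_proj (S n) (hS n) v] at h1
      rw [← h1.tsum_eq, ENNReal.ofReal_tsum_of_nonneg (fun n => by positivity) h1.summable])

open Classical in
/-- The bounded Borel functional calculus: for bounded Borel `g`, `E.fn g` is the operator `g(H)`,
the unique bounded operator with `(v | g(H) v) = ∫ g dμ_v` for all `v`. (It is `0` if there is no
such operator, which does not happen for bounded Borel `g`.) -/
def fn (g : ℝ → ℂ) : 𝓗 →L[ℂ] 𝓗 :=
  if h : ∃ T : 𝓗 →L[ℂ] 𝓗, ∀ v, ⟪v, T v⟫_ℂ = ∫ x, g x ∂(E.measure v) then h.choose else 0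

/-- The unitary group `e^{itH}`. -/
def unitaryGroup (t : ℝ) : 𝓗 →L[ℂ] 𝓗 :=
  E.fn (fun x => Complex.exp (Complex.I * t * x))

end SpectralResolution

/-! ## Tensor powers with their inner product -/

section TensorPower

/-- The inner product pulled back along an injective linear map. -/
@[reducible] def pullbackCore {E F : Type*} [AddCommGroup E] [Module ℂ E] [NormedAddCommGroup F]
    [InnerProductSpace ℂ F] (f : E →ₗ[ℂ] F) (hf : Function.Injective f) :
    InnerProductSpace.Core ℂ E where
  inner x y := ⟪f x, f y⟫_ℂ
  conj_inner_symm x y := inner_conj_symm _ _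
  re_inner_nonneg x := inner_self_nonneg
  add_left x y z := by rw [map_add, inner_add_left]
  smul_left x y r := by rw [map_smul, inner_smul_left]
  definite x hx := hf (by simpa using inner_self_eq_zero.mp hx)

variable (𝓗 : Type*) [NormedAddCommGroup 𝓗] [InnerProductSpace ℂ 𝓗]

/-- The algebraic `n`-th tensor power of `𝓗`; below it gets its Hilbert space inner product
`(x₁ ⊗ ⋯ ⊗ xₙ | y₁ ⊗ ⋯ ⊗ yₙ) = ∏ (xᵢ | yᵢ)`. -/
def TPow (n : ℕ) := ⨂[ℂ] (_ : Fin n), 𝓗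

instance (n : ℕ) : AddCommGroup (TPow 𝓗 n) := inferInstanceAs (AddCommGroup (⨂[ℂ] (_ : Fin n), 𝓗))
instance (n : ℕ) : Module ℂ (TPow 𝓗 n) := inferInstanceAs (Module ℂ (⨂[ℂ] (_ : Fin n), 𝓗))

/-- The elementary tensor `x₁ ⊗ ⋯ ⊗ xₙ`, as a multilinear map. -/
def tpure (n : ℕ) : MultilinearMap ℂ (fun _ : Fin n => 𝓗) (TPow 𝓗 n) :=
  PiTensorProduct.tprod ℂ

variable {𝓗} in
theorem tpow_ext {n : ℕ} {F : Type*} [AddCommMonoid F] [Module ℂ F] {f g : TPow 𝓗 n →ₗ[ℂ] F}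
    (h : ∀ x, f (tpure 𝓗 n x) = g (tpure 𝓗 n x)) : f = g :=
  PiTensorProduct.ext (MultilinearMap.ext h)

/-- The zeroth tensor power is `ℂ`. -/
def tpowZero : TPow 𝓗 0 ≃ₗ[ℂ] ℂ := PiTensorProduct.isEmptyEquiv (Fin 0)

/-- The map `x₁ ⊗ ⋯ ⊗ x_{n+1} ↦ x₁ ⊗ (x₂ ⊗ ⋯ ⊗ x_{n+1})`. -/
def tpowSplit (n : ℕ) : TPow 𝓗 (n + 1) →ₗ[ℂ] 𝓗 ⊗[ℂ] TPow 𝓗 n :=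
  PiTensorProduct.lift (LinearMap.uncurryLeft (M := fun _ : Fin (n + 1) => 𝓗)
    { toFun := fun h => (TensorProduct.mk ℂ 𝓗 (TPow 𝓗 n) h).compMultilinearMap (tpure 𝓗 n)
      map_add' := fun x y => by ext; simp
      map_smul' := fun c x => by ext; simp })

/-- The map `x₁ ⊗ (x₂ ⊗ ⋯ ⊗ x_{n+1}) ↦ x₁ ⊗ ⋯ ⊗ x_{n+1}`. -/
def tpowCons (n : ℕ) : 𝓗 ⊗[ℂ] TPow 𝓗 n →ₗ[ℂ] TPow 𝓗 (n + 1) :=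
  TensorProduct.lift
    ((PiTensorProduct.lift (R := ℂ) (s := fun _ : Fin n => 𝓗) (E := TPow 𝓗 (n + 1))).toLinearMap
      ∘ₗ (tpure 𝓗 (n + 1)).curryLeft)

theorem tpowSplit_tpure (n : ℕ) (x : Fin (n + 1) → 𝓗) :
    tpowSplit 𝓗 n (tpure 𝓗 (n + 1) x) = x 0 ⊗ₜ tpure 𝓗 n (Fin.tail x) := by
  refine (PiTensorProduct.lift.tprod (R := ℂ) (s := fun _ : Fin (n + 1) => 𝓗) x).trans ?_
  simp

theorem tpowCons_tmul_tpure (n : ℕ) (h : 𝓗) (x : Fin n → 𝓗) :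
    tpowCons 𝓗 n (h ⊗ₜ tpure 𝓗 n x) = tpure 𝓗 (n + 1) (Fin.cons h x) := by
  simp only [tpowCons, TensorProduct.lift.tmul]
  refine (PiTensorProduct.lift.tprod (R := ℂ) (s := fun _ : Fin n => 𝓗) x).trans ?_
  simp

/-- Splitting off the first factor: `𝓗^{⊗(n+1)} = 𝓗 ⊗ 𝓗^{⊗n}`. -/
def tpowSucc (n : ℕ) : TPow 𝓗 (n + 1) ≃ₗ[ℂ] 𝓗 ⊗[ℂ] TPow 𝓗 n :=
  LinearEquiv.ofLinearMap (tpowSplit 𝓗 n) (tpowCons 𝓗 n)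
    (by
      refine TensorProduct.ext (LinearMap.ext fun h => tpow_ext fun x => ?_)
      simp [tpowCons_tmul_tpure, tpowSplit_tpure])
    (by
      refine tpow_ext fun x => ?_
      simp [tpowCons_tmul_tpure, tpowSplit_tpure])

/-- The inner product on the tensor powers, by recursion. -/
@[reducible] def tpowCore : ∀ n : ℕ, InnerProductSpace.Core ℂ (TPow 𝓗 n)
  | 0 => pullbackCore (tpowZero 𝓗).toLinearMap (tpowZero 𝓗).injective
  | n + 1 =>
    letI := tpowCore n
    letI : NormedAddCommGroup (TPow 𝓗 n) := InnerProductSpace.Core.toNormedAddCommGroup (𝕜 := ℂ)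
    letI : InnerProductSpace ℂ (TPow 𝓗 n) := InnerProductSpace.ofCore _
    pullbackCore (tpowSucc 𝓗 n).toLinearMap (tpowSucc 𝓗 n).injective

instance (n : ℕ) : NormedAddCommGroup (TPow 𝓗 n) :=
  letI := tpowCore 𝓗 n
  InnerProductSpace.Core.toNormedAddCommGroup (𝕜 := ℂ)

instance (n : ℕ) : InnerProductSpace ℂ (TPow 𝓗 n) :=
  letI := tpowCore 𝓗 n
  InnerProductSpace.ofCore _

theorem inner_tpowSucc (n : ℕ) (x y : TPow 𝓗 (n + 1)) :
    ⟪tpowSucc 𝓗 n x, tpowSucc 𝓗 n y⟫_ℂ = ⟪x, y⟫_ℂ := rfl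

theorem inner_tpure (n : ℕ) (x y : Fin n → 𝓗) :
    ⟪tpure 𝓗 n x, tpure 𝓗 n y⟫_ℂ = ∏ i, ⟪x i, y i⟫_ℂ := by
  induction n with
  | zero =>
    change ⟪tpowZero 𝓗 (tpure 𝓗 0 x), tpowZero 𝓗 (tpure 𝓗 0 y)⟫_ℂ = _
    have h (z : Fin 0 → 𝓗) : tpowZero 𝓗 (tpure 𝓗 0 z) = 1 :=
      PiTensorProduct.isEmptyEquiv_apply_tprod (R := ℂ) (s := fun _ : Fin 0 => 𝓗) (Fin 0) z
    simp [h]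
  | succ n ih =>
    rw [← inner_tpowSucc, Fin.prod_univ_succ]
    change ⟪tpowSplit 𝓗 n _, tpowSplit 𝓗 n _⟫_ℂ = _
    rw [tpowSplit_tpure, tpowSplit_tpure, TensorProduct.inner_tmul, ih]
    rfl

/-- The action of a permutation on the factors. -/
def tperm (n : ℕ) (σ : Equiv.Perm (Fin n)) : TPow 𝓗 n ≃ₗ[ℂ] TPow 𝓗 n :=
  PiTensorProduct.reindex ℂ (fun _ => 𝓗) σ

theorem tperm_tpure (n : ℕ) (σ : Equiv.Perm (Fin n)) (x : Fin n → 𝓗) :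
    tperm 𝓗 n σ (tpure 𝓗 n x) = tpure 𝓗 n (fun i => x (σ.symm i)) :=
  PiTensorProduct.reindex_tprod (R := ℂ) (s := fun _ : Fin n => 𝓗) σ x

theorem tperm_tperm (n : ℕ) (σ τ : Equiv.Perm (Fin n)) (x : TPow 𝓗 n) :
    tperm 𝓗 n σ (tperm 𝓗 n τ x) = tperm 𝓗 n (σ * τ) x := by
  have : (tperm 𝓗 n σ).toLinearMap ∘ₗ (tperm 𝓗 n τ).toLinearMap =
      (tperm 𝓗 n (σ * τ)).toLinearMap :=
    tpow_ext fun x => by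
      simp [tperm_tpure, Equiv.Perm.mul_def]
  exact LinearMap.congr_fun this x

/-- The symmetric tensors `⊗ₛⁿ 𝓗`. -/
def SymPow (n : ℕ) : Submodule ℂ (TPow 𝓗 n) where
  carrier := {x | ∀ σ, tperm 𝓗 n σ x = x}
  add_mem' hx hy σ := by rw [map_add, hx σ, hy σ]
  zero_mem' σ := map_zero _
  smul_mem' c x hx σ := by rw [map_smul, hx σ]

theorem mem_symPow {n : ℕ} {x : TPow 𝓗 n} : x ∈ SymPow 𝓗 n ↔ ∀ σ, tperm 𝓗 n σ x = x := Iff.rfl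

/-- The projection `(1/n!) ∑_σ σ` of the tensor power onto the symmetric tensors. -/
def symmetrize (n : ℕ) : TPow 𝓗 n →ₗ[ℂ] SymPow 𝓗 n :=
  LinearMap.codRestrict (SymPow 𝓗 n)
    (((n.factorial : ℂ)⁻¹) • ∑ σ : Equiv.Perm (Fin n), (tperm 𝓗 n σ).toLinearMap)
    (fun x => by
      rw [mem_symPow]
      intro τ
      simp only [LinearMap.smul_apply, LinearMap.sum_apply, LinearEquiv.coe_coe, map_smul, map_sum,
        tperm_tperm]
      congr 1
      exact Fintype.sum_equiv (Equiv.mulLeft τ) _ _ fun σ => rfl)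

theorem coe_symmetrize (n : ℕ) (x : TPow 𝓗 n) :
    (symmetrize 𝓗 n x : TPow 𝓗 n) =
      ((n.factorial : ℂ)⁻¹) • ∑ σ : Equiv.Perm (Fin n), tperm 𝓗 n σ x := by
  simp [symmetrize]

/-- `q ⊗ ⋯ ⊗ q` on the tensor power. -/
def tmap (n : ℕ) (q : 𝓗 →L[ℂ] 𝓗) : TPow 𝓗 n →ₗ[ℂ] TPow 𝓗 n :=
  PiTensorProduct.map (fun _ => (q : 𝓗 →ₗ[ℂ] 𝓗))

variable {𝓗} in
theorem tpow_induction {n : ℕ} {p : TPow 𝓗 n → Prop}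
    (h1 : ∀ (c : ℂ) (x : Fin n → 𝓗), p (c • tpure 𝓗 n x))
    (h2 : ∀ x y, p x → p y → p (x + y)) (x : TPow 𝓗 n) : p x :=
  PiTensorProduct.induction_on (R := ℂ) (s := fun _ : Fin n => 𝓗) x h1 (fun {x y} => h2 x y)

theorem inner_tperm_tperm (n : ℕ) (σ : Equiv.Perm (Fin n)) (x y : TPow 𝓗 n) :
    ⟪tperm 𝓗 n σ x, tperm 𝓗 n σ y⟫_ℂ = ⟪x, y⟫_ℂ := by
  induction x using tpow_induction with
  | h1 c x =>
    induction y using tpow_induction with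
    | h1 d y =>
      simp only [map_smul, inner_smul_left, inner_smul_right, tperm_tpure, inner_tpure]
      rw [Equiv.prod_comp σ.symm (fun i => ⟪x i, y i⟫_ℂ)]
    | h2 y z hy hz => rw [map_add, inner_add_right, hy, hz, inner_add_right]
  | h2 x z hx hz => rw [map_add, inner_add_left, hx, hz, inner_add_left]

/-- `symmetrize` is the orthogonal projection onto the symmetric tensors. -/
theorem inner_symmetrize (n : ℕ) (x : TPow 𝓗 n) (y : SymPow 𝓗 n) :
    ⟪symmetrize 𝓗 n x, y⟫_ℂ = ⟪x, (y : TPow 𝓗 n)⟫_ℂ := by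
  have h (σ : Equiv.Perm (Fin n)) : ⟪tperm 𝓗 n σ x, (y : TPow 𝓗 n)⟫_ℂ = ⟪x, (y : TPow 𝓗 n)⟫_ℂ := by
    conv_lhs => rw [← y.2 σ]
    exact inner_tperm_tperm 𝓗 n σ x y
  rw [Submodule.coe_inner, coe_symmetrize]
  simp only [inner_smul_left, sum_inner, h]
  simp [Fintype.card_perm, Nat.factorial_ne_zero]

end TensorPower

section
variable {E F G : Type*} [NormedAddCommGroup E] [InnerProductSpace ℂ E] [NormedAddCommGroup F]
  [InnerProductSpace ℂ F] [NormedAddCommGroup G] [InnerProductSpace ℂ G]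

theorem inner_lTensor_left {f : E →ₗ[ℂ] F} {g : F →ₗ[ℂ] E} (h : ∀ x y, ⟪f x, y⟫_ℂ = ⟪x, g y⟫_ℂ)
    (x : G ⊗[ℂ] E) (y : G ⊗[ℂ] F) : ⟪f.lTensor G x, y⟫_ℂ = ⟪x, g.lTensor G y⟫_ℂ := by
  induction x using TensorProduct.induction_on with
  | zero => simp
  | add x x' hx hx' => rw [map_add, inner_add_left, hx, hx', inner_add_left]
  | tmul a b =>
    induction y using TensorProduct.induction_on with
    | zero => simp
    | add x x' hx hx' => rw [map_add, inner_add_right, hx, hx', inner_add_right]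
    | tmul c d => simp [h]

theorem inner_rTensor_left {f : E →ₗ[ℂ] F} {g : F →ₗ[ℂ] E} (h : ∀ x y, ⟪f x, y⟫_ℂ = ⟪x, g y⟫_ℂ)
    (x : E ⊗[ℂ] G) (y : F ⊗[ℂ] G) : ⟪f.rTensor G x, y⟫_ℂ = ⟪x, g.rTensor G y⟫_ℂ := by
  induction x using TensorProduct.induction_on with
  | zero => simp
  | add x x' hx hx' => rw [map_add, inner_add_left, hx, hx', inner_add_left]
  | tmul a b =>
    induction y using TensorProduct.induction_on with
    | zero => simp
    | add x x' hx hx' => rw [map_add, inner_add_right, hx, hx', inner_add_right]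
    | tmul c d => simp [h]
end
/-! ## The small system coupled to the bosonic reservoir -/

section Coupling

universe u v

/-- For finite dimensional `𝒦` the algebraic tensor product `𝒦 ⊗ 𝓡` is the Hilbert tensor
product. -/
instance completeSpace_tensor (𝒦 : Type u) [NormedAddCommGroup 𝒦] [InnerProductSpace ℂ 𝒦]
    [FiniteDimensional ℂ 𝒦] (𝓡 : Type v) [NormedAddCommGroup 𝓡] [InnerProductSpace ℂ 𝓡]
    [CompleteSpace 𝓡] : CompleteSpace (𝒦 ⊗[ℂ] 𝓡) := by
  let b := stdOrthonormalBasis ℂ 𝒦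
  let L : PiLp 2 (fun _ : Fin (Module.finrank ℂ 𝒦) => 𝓡) →ₗ[ℂ] 𝒦 ⊗[ℂ] 𝓡 :=
    { toFun := fun x => ∑ i, b i ⊗ₜ[ℂ] x i
      map_add' := fun x y => by simp [TensorProduct.tmul_add, Finset.sum_add_distrib]
      map_smul' := fun c x => by simp [Finset.smul_sum] }
  have hL : ∀ x y, ⟪L x, L y⟫_ℂ = ⟪x, y⟫_ℂ := fun x y => by
    simp [L, sum_inner, inner_sum, PiLp.inner_apply, OrthonormalBasis.inner_eq_ite]
  have hs : Function.Surjective (L.isometryOfInner hL) := by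
    intro z
    induction z using TensorProduct.induction_on with
    | zero => exact ⟨0, map_zero _⟩
    | add x y hx hy =>
      obtain ⟨x', rfl⟩ := hx
      obtain ⟨y', rfl⟩ := hy
      exact ⟨x' + y', map_add _ _ _⟩
    | tmul k r =>
      refine ⟨WithLp.toLp 2 (fun i => (⟪b i, k⟫_ℂ) • r), ?_⟩
      change ∑ i, b i ⊗ₜ[ℂ] ((⟪b i, k⟫_ℂ) • r) = _
      conv_rhs => rw [← b.sum_repr k, TensorProduct.sum_tmul]
      refine Finset.sum_congr rfl fun i _ => ?_
      rw [TensorProduct.smul_tmul, b.repr_apply_apply]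
  exact (LinearIsometryEquiv.ofSurjective _ hs).symm.toIsometryEquiv.completeSpace

section Identification

variable {𝒦 : Type u} [NormedAddCommGroup 𝒦] [InnerProductSpace ℂ 𝒦]
  {𝓡 : Type v} [NormedAddCommGroup 𝓡] [InnerProductSpace ℂ 𝓡]

/-- The identification `(𝒦 ⊗ 𝓡) ⊗ 𝓡^{⊗n} = 𝒦 ⊗ 𝓡^{⊗(n+1)}`. -/
def absorb (n : ℕ) : (𝒦 ⊗[ℂ] 𝓡) ⊗[ℂ] TPow 𝓡 n →ₗ[ℂ] 𝒦 ⊗[ℂ] TPow 𝓡 (n + 1) :=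
  (tpowSucc 𝓡 n).symm.toLinearMap.lTensor 𝒦 ∘ₗ (TensorProduct.assoc ℂ 𝒦 𝓡 (TPow 𝓡 n)).toLinearMap

/-- The identification `𝒦 ⊗ 𝓡^{⊗(n+1)} = (𝒦 ⊗ 𝓡) ⊗ 𝓡^{⊗n}`. -/
def expose (n : ℕ) : 𝒦 ⊗[ℂ] TPow 𝓡 (n + 1) →ₗ[ℂ] (𝒦 ⊗[ℂ] 𝓡) ⊗[ℂ] TPow 𝓡 n :=
  (TensorProduct.assoc ℂ 𝒦 𝓡 (TPow 𝓡 n)).symm.toLinearMap ∘ₗ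
    (tpowSucc 𝓡 n).toLinearMap.lTensor 𝒦

theorem inner_expose (n : ℕ) (x : 𝒦 ⊗[ℂ] TPow 𝓡 (n + 1)) (y : (𝒦 ⊗[ℂ] 𝓡) ⊗[ℂ] TPow 𝓡 n) :
    ⟪expose n x, y⟫_ℂ = ⟪x, absorb n y⟫_ℂ := by
  have h1 : ∀ (a : TPow 𝓡 (n + 1)) (b : 𝓡 ⊗[ℂ] TPow 𝓡 n),
      ⟪(tpowSucc 𝓡 n).toLinearMap a, b⟫_ℂ = ⟪a, (tpowSucc 𝓡 n).symm.toLinearMap b⟫_ℂ := by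
    intro a b
    rw [← inner_tpowSucc]
    simp
  rw [absorb, LinearMap.comp_apply, ← inner_lTensor_left h1, expose, LinearMap.comp_apply]
  rw [← TensorProduct.inner_assoc_assoc]
  simp

end Identification

variable {𝒦 : Type u} [NormedAddCommGroup 𝒦] [InnerProductSpace ℂ 𝒦] [FiniteDimensional ℂ 𝒦]
  [CompleteSpace 𝒦] {𝓡 : Type v} [NormedAddCommGroup 𝓡] [InnerProductSpace ℂ 𝓡] [CompleteSpace 𝓡]

variable (𝒦 𝓡) in
/-- The finite-particle vectors `⨁ₙ 𝒦 ⊗ ⊗ₛⁿ 𝓡` of `𝒦 ⊗ Γₛ(𝓡)` (algebraic Fock space): the common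
dense invariant domain of the operators `a(V)`, `a*(V)`, `D ⊗ 1` and `e^{itH₀}`. -/
abbrev FockDomain : Type (max u v) := ⨁ n : ℕ, 𝒦 ⊗[ℂ] SymPow 𝓡 n

/-- `a(V) = √(n+1) V* ⊗ 1^{⊗n}` on the `(n+1)`-particle space. The result of `V* ⊗ 1^{⊗n}` is
already symmetric; `symmetrize` only records this in the type. -/
def annihilationN (V : 𝒦 →L[ℂ] 𝒦 ⊗[ℂ] 𝓡) (n : ℕ) :
    𝒦 ⊗[ℂ] SymPow 𝓡 (n + 1) →ₗ[ℂ] 𝒦 ⊗[ℂ] SymPow 𝓡 n :=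
  ((Real.sqrt (n + 1) : ℝ) : ℂ) • ((symmetrize 𝓡 n).lTensor 𝒦 ∘ₗ
    ((ContinuousLinearMap.adjoint V : 𝒦 ⊗[ℂ] 𝓡 →L[ℂ] 𝒦) : 𝒦 ⊗[ℂ] 𝓡 →ₗ[ℂ] 𝒦).rTensor (TPow 𝓡 n) ∘ₗ
    expose n ∘ₗ (SymPow 𝓡 (n + 1)).subtype.lTensor 𝒦)

/-- `a*(V) = √(n+1) (1 ⊗ S_{n+1}) (V ⊗ 1^{⊗n})` on the `n`-particle space, `S` being the projection
onto the symmetric tensors; this is the adjoint of `a(V)`, see `inner_annihilationN`. -/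
def creationN (V : 𝒦 →L[ℂ] 𝒦 ⊗[ℂ] 𝓡) (n : ℕ) :
    𝒦 ⊗[ℂ] SymPow 𝓡 n →ₗ[ℂ] 𝒦 ⊗[ℂ] SymPow 𝓡 (n + 1) :=
  ((Real.sqrt (n + 1) : ℝ) : ℂ) • ((symmetrize 𝓡 (n + 1)).lTensor 𝒦 ∘ₗ absorb n ∘ₗ
    (V : 𝒦 →ₗ[ℂ] 𝒦 ⊗[ℂ] 𝓡).rTensor (TPow 𝓡 n) ∘ₗ (SymPow 𝓡 n).subtype.lTensor 𝒦)

/-- `a(V)` and `a*(V)` are adjoint to each other. -/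
theorem inner_annihilationN (V : 𝒦 →L[ℂ] 𝒦 ⊗[ℂ] 𝓡) (n : ℕ) (Ψ : 𝒦 ⊗[ℂ] SymPow 𝓡 (n + 1))
    (Φ : 𝒦 ⊗[ℂ] SymPow 𝓡 n) : ⟪annihilationN V n Ψ, Φ⟫_ℂ = ⟪Ψ, creationN V n Φ⟫_ℂ := by
  have hs (m : ℕ) (x : TPow 𝓡 m) (y : SymPow 𝓡 m) :
      ⟪symmetrize 𝓡 m x, y⟫_ℂ = ⟪x, (SymPow 𝓡 m).subtype y⟫_ℂ := inner_symmetrize 𝓡 m x y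
  have hs' (m : ℕ) (x : SymPow 𝓡 m) (y : TPow 𝓡 m) :
      ⟪(SymPow 𝓡 m).subtype x, y⟫_ℂ = ⟪x, symmetrize 𝓡 m y⟫_ℂ := by
    rw [← inner_conj_symm (𝕜 := ℂ) ((SymPow 𝓡 m).subtype x) y, ← hs,
      inner_conj_symm (𝕜 := ℂ) x (symmetrize 𝓡 m y)]
  have hV (x : 𝒦 ⊗[ℂ] 𝓡) (y : 𝒦) :
      ⟪((ContinuousLinearMap.adjoint V : 𝒦 ⊗[ℂ] 𝓡 →L[ℂ] 𝒦) : 𝒦 ⊗[ℂ] 𝓡 →ₗ[ℂ] 𝒦) x, y⟫_ℂ =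
        ⟪x, (V : 𝒦 →ₗ[ℂ] 𝒦 ⊗[ℂ] 𝓡) y⟫_ℂ := ContinuousLinearMap.adjoint_inner_left V y x
  simp only [annihilationN, creationN, LinearMap.smul_apply, LinearMap.comp_apply]
  refine (inner_smul_left (𝕜 := ℂ) (E := 𝒦 ⊗[ℂ] SymPow 𝓡 n) _ _ _).trans (Eq.trans ?_
    (inner_smul_right (𝕜 := ℂ) (E := 𝒦 ⊗[ℂ] SymPow 𝓡 (n + 1)) _ _ _).symm)
  rw [Complex.conj_ofReal]
  congr 1
  refine (inner_lTensor_left (hs n) _ _).trans ((inner_rTensor_left hV _ _).trans ?_)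
  exact (inner_expose n _ _).trans (inner_lTensor_left (hs' (n + 1)) _ _)

/-- The annihilation operator `a(V)`. -/
def annihilation (V : 𝒦 →L[ℂ] 𝒦 ⊗[ℂ] 𝓡) : FockDomain 𝒦 𝓡 →ₗ[ℂ] FockDomain 𝒦 𝓡 :=
  DirectSum.toModule ℂ ℕ _ fun
    | 0 => 0
    | n + 1 => DirectSum.lof ℂ ℕ (fun n => 𝒦 ⊗[ℂ] SymPow 𝓡 n) n ∘ₗ annihilationN V n

/-- The creation operator `a*(V)`. -/
def creation (V : 𝒦 →L[ℂ] 𝒦 ⊗[ℂ] 𝓡) : FockDomain 𝒦 𝓡 →ₗ[ℂ] FockDomain 𝒦 𝓡 :=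
  DirectSum.toModule ℂ ℕ _ fun n =>
    DirectSum.lof ℂ ℕ (fun n => 𝒦 ⊗[ℂ] SymPow 𝓡 n) (n + 1) ∘ₗ creationN V n

/-- The operator `D ⊗ 1`. -/
def small (D : 𝒦 →L[ℂ] 𝒦) : FockDomain 𝒦 𝓡 →ₗ[ℂ] FockDomain 𝒦 𝓡 :=
  DirectSum.lmap fun n => (D : 𝒦 →ₗ[ℂ] 𝒦).rTensor (SymPow 𝓡 n)

/-- The field-type operator `B = (D ⊗ 1) (a*(V) + a(V)) (D' ⊗ 1)`. -/
def fieldOp (V : 𝒦 →L[ℂ] 𝒦 ⊗[ℂ] 𝓡) (D D' : 𝒦 →L[ℂ] 𝒦) : FockDomain 𝒦 𝓡 →ₗ[ℂ] FockDomain 𝒦 𝓡 :=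
  small D ∘ₗ (creation V + annihilation V) ∘ₗ small D'

/-- `Γ(q) = q ⊗ ⋯ ⊗ q` on the `n`-particle space `⊗ₛⁿ 𝓡`. Again the result is already symmetric. -/
def secondQuantN (q : 𝓡 →L[ℂ] 𝓡) (n : ℕ) : SymPow 𝓡 n →ₗ[ℂ] SymPow 𝓡 n :=
  symmetrize 𝓡 n ∘ₗ tmap 𝓡 n q ∘ₗ (SymPow 𝓡 n).subtype

/-- The free unitary group `e^{itH₀}`, `H₀ = K ⊗ 1 + 1 ⊗ dΓ(H_R)`, that is,
`e^{itK} ⊗ Γ(e^{itH_R})`. Here `E` is the spectral resolution of `H_R`. -/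
def freeUnitary (K : 𝒦 →L[ℂ] 𝒦) (E : SpectralResolution 𝓡) (t : ℝ) :
    FockDomain 𝒦 𝓡 →ₗ[ℂ] FockDomain 𝒦 𝓡 :=
  DirectSum.lmap fun n =>
    TensorProduct.map ((NormedSpace.exp ((Complex.I * t) • K) : 𝒦 →L[ℂ] 𝒦) : 𝒦 →ₗ[ℂ] 𝒦)
      (secondQuantN (E.unitaryGroup t) n)

/-- The free Heisenberg dynamics `τ_t(C) = e^{itH₀} C e^{-itH₀}`. -/
def freeDynamics (K : 𝒦 →L[ℂ] 𝒦) (E : SpectralResolution 𝓡) (t : ℝ)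
    (C : FockDomain 𝒦 𝓡 →ₗ[ℂ] FockDomain 𝒦 𝓡) : FockDomain 𝒦 𝓡 →ₗ[ℂ] FockDomain 𝒦 𝓡 :=
  freeUnitary K E t ∘ₗ C ∘ₗ freeUnitary K E (-t)

variable (𝓡) in
/-- The vacuum `Ω = 1 ∈ ⊗ₛ⁰ 𝓡 = ℂ`. -/
def vacuum : SymPow 𝓡 0 :=
  ⟨(tpowZero 𝓡).symm 1, fun σ => by
    rw [Subsingleton.elim σ 1]
    exact LinearEquiv.congr_fun
      (PiTensorProduct.reindex_refl (R := ℂ) (s := fun _ : Fin 0 => 𝓡)) ((tpowZero 𝓡).symm 1)⟩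

variable (𝒦 𝓡) in
/-- The embedding `|Ω) : 𝒦 → 𝒦 ⊗ Γₛ(𝓡)`, `k ↦ k ⊗ Ω`. -/
def vacuumKet : 𝒦 →ₗ[ℂ] FockDomain 𝒦 𝓡 :=
  DirectSum.lof ℂ ℕ (fun n => 𝒦 ⊗[ℂ] SymPow 𝓡 n) 0 ∘ₗ
    (TensorProduct.mk ℂ 𝒦 (SymPow 𝓡 0)).flip (vacuum 𝓡)

variable (𝒦 𝓡) in
/-- The adjoint `(Ω| : 𝒦 ⊗ Γₛ(𝓡) → 𝒦` of `|Ω)`. -/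
def vacuumBra : FockDomain 𝒦 𝓡 →ₗ[ℂ] 𝒦 :=
  (TensorProduct.rid ℂ 𝒦).toLinearMap ∘ₗ
    (innerSL ℂ (vacuum 𝓡) : SymPow 𝓡 0 →ₗ[ℂ] ℂ).lTensor 𝒦 ∘ₗ
    DirectSum.component ℂ ℕ (fun n => 𝒦 ⊗[ℂ] SymPow 𝓡 n) 0

/-- The functional `ω_β(C) = Tr (e^{-βK} ⊗ |Ω)(Ω|) C = Tr_𝒦 e^{-βK} (Ω|C|Ω)`. -/
def thermalState (β : ℝ) (K : 𝒦 →L[ℂ] 𝒦) (C : FockDomain 𝒦 𝓡 →ₗ[ℂ] FockDomain 𝒦 𝓡) : ℂ :=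
  LinearMap.trace ℂ 𝒦
    (((NormedSpace.exp ((-β : ℂ) • K) : 𝒦 →L[ℂ] 𝒦) : 𝒦 →ₗ[ℂ] 𝒦) ∘ₗ
      vacuumBra 𝒦 𝓡 ∘ₗ C ∘ₗ vacuumKet 𝒦 𝓡)

/-- `F` is the analytic continuation of `g : ℝ → ℂ` to the strip `0 ≤ Im z ≤ β`: bounded and
continuous on the closed strip, holomorphic inside, with boundary value `g` on `ℝ`. -/
structure IsStripContinuation (β : ℝ) (g : ℝ → ℂ) (F : ℂ → ℂ) : Prop where
  diffContOnCl : DiffContOnCl ℂ F {z | 0 < z.im ∧ z.im < β}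
  bounded : ∃ M : ℝ, ∀ z : ℂ, 0 ≤ z.im → z.im ≤ β → ‖F z‖ ≤ M
  boundary : ∀ t : ℝ, F t = g t

/-- The KMS identity `ω_β(τ_t(B₁) B₂) = ω_β(B₂ τ_{t+iβ}(B₁))`, `t ∈ ℝ`, for all field-type operators
`B₁, B₂`. As usual, `ω_β(B₂ τ_{t+iβ}(B₁))` is the value at `t + iβ` of the analytic continuation of
`t ↦ ω_β(B₂ τ_t(B₁))` to the strip `0 ≤ Im z ≤ β`. -/
def KMSIdentity (β : ℝ) (K : 𝒦 →L[ℂ] 𝒦) (E : SpectralResolution 𝓡) (V : 𝒦 →L[ℂ] 𝒦 ⊗[ℂ] 𝓡) : Prop :=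
  ∀ D₁ D₂ D₁' D₂' : 𝒦 →L[ℂ] 𝒦,
    ∃ F : ℂ → ℂ,
      IsStripContinuation β
        (fun t => thermalState β K (fieldOp V D₂ D₂' ∘ₗ freeDynamics K E t (fieldOp V D₁ D₁'))) F ∧
      ∀ t : ℝ,
        thermalState β K (freeDynamics K E t (fieldOp V D₁ D₁') ∘ₗ fieldOp V D₂ D₂') =
          F (t + Complex.I * β)

/-- `T = Tr_𝓡 X`, the partial trace of the operator `X` on `𝒦 ⊗ 𝓡`: the matrix elements of `T` are
`∑ᵢ (φ ⊗ wᵢ | X (ψ ⊗ wᵢ))`, for every orthonormal basis `w` of `𝓡`. -/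
def IsPartialTrace (X : 𝒦 ⊗[ℂ] 𝓡 →L[ℂ] 𝒦 ⊗[ℂ] 𝓡) (T : 𝒦 →L[ℂ] 𝒦) : Prop :=
  ∀ (ι : Type v) (w : HilbertBasis ι ℂ 𝓡) (φ ψ : 𝒦),
    HasSum (fun i => ⟪φ ⊗ₜ[ℂ] w i, X (ψ ⊗ₜ[ℂ] w i)⟫_ℂ) ⟪φ, T ψ⟫_ℂ

/-- `T = V* (A ⊗ g(H_R)) V` for a Borel function `g` bounded on bounded sets. For unbounded `g` the
operator is understood by means of the spectral cutoffs `1_{[-n,n]}(H_R) g(H_R)`. -/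
def IsCompression (E : SpectralResolution 𝓡) (V : 𝒦 →L[ℂ] 𝒦 ⊗[ℂ] 𝓡) (A : 𝒦 →L[ℂ] 𝒦)
    (g : ℝ → ℂ) (T : 𝒦 →L[ℂ] 𝒦) : Prop :=
  Filter.Tendsto (fun n : ℕ =>
      ContinuousLinearMap.adjoint V ∘L
        TensorProduct.mapL A (E.fn ((Set.Icc (-n : ℝ) n).indicator g)) ∘L V)
    Filter.atTop (nhds T)

/-- The reservoir is thermal at inverse temperature `β`:
`Tr_𝓡 (1 ⊗ f(-H_R)) V A V* = V* (A ⊗ e^{-βH_R} f(H_R)) V` for all bounded Borel functions `f` and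
all `A ∈ B(𝒦)` (both sides being well defined). -/
def IsThermalReservoir (β : ℝ) (E : SpectralResolution 𝓡) (V : 𝒦 →L[ℂ] 𝒦 ⊗[ℂ] 𝓡) : Prop :=
  ∀ f : ℝ → ℂ, Measurable f → (∃ M : ℝ, ∀ x, ‖f x‖ ≤ M) →
    ∀ A : 𝒦 →L[ℂ] 𝒦, ∃ T : 𝒦 →L[ℂ] 𝒦,
      IsPartialTrace
        (TensorProduct.mapL (1 : 𝒦 →L[ℂ] 𝒦) (E.fn fun x => f (-x)) ∘L V ∘L A ∘L
          ContinuousLinearMap.adjoint V) T ∧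
      IsCompression E V A (fun x => (Real.exp (-β * x) : ℂ) * f x) T

end Coupling

end PauliFierz
end

set_option linter.unusedSectionVars false

noncomputable section

namespace PauliFierz

open MeasureTheory Filter Topology

/-! ### Bounded Borel functional calculus and polarization of spectral measures. -/

namespace SpectralResolution

variable {𝓗 : Type*} [NormedAddCommGroup 𝓗] [InnerProductSpace ℂ 𝓗] [CompleteSpace 𝓗]
  (E : SpectralResolution 𝓗)

/-! In the vacuum expectation of a product of two field operators only the path vacuum, one
particle, vacuum survives, so both correlation functions are traces over `𝒦` of expressions built
from `V* (Q ⊗ e^{±itH_R}) V`. In an eigenbasis `b` of `K` with eigenvalues `κ`, write `V b_j = ∑ b_i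
⊗ v_ij`. The correlations become finite sums of matrix elements `(v_id | e^{itH_R} v_jc)`,
respectively `(v_cj | e^{-itH_R} v_di)`, times coefficients that depend on time through exponentials
of the `κ_i`. Because of the factor `e^{-βK}` these coefficients are the same entire functions on
both sides, taken at `t` and at `t + iβ`. Rank-one choices of the `D`'s isolate one summand and its
nonvanishing exponential can be divided out. Thus `K` disappears and the KMS identity is equivalent
to `ComponentKMS`, a statement about the vectors `v_ij` alone.

Let `μ = (v_id | E(·) v_jc)` and let `ν` be the reflection under `x ↦ -x` of `(v_cj | E(·) v_di)`.
`ComponentKMS` says that the Fourier transform of `μ` continues to the strip with the Fourier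
transform of `ν` on the upper edge. `DetailedBalance` says that `e^{-βx} μ = ν`. From the first to
the second (`sum_integral_exp_mul_eq`): pair the continuation with a Gaussian and shift the contour,
which gives `e^{-x²/2} μ = e^{βx - x²/2} ν` by Fourier uniqueness, and then cancel the weights on
bounded sets. Conversely, the diagonal case makes `e^{-βx}` integrable for the positive measures of
the `v_ij`, hence for all measures in the polarization identity, and `∫ e^{izx} dμ` is the
continuation.

Finally, `DetailedBalance` is the thermal condition in matrix elements: Parseval evaluates the
partial trace (`hasSum_inner_tmul`), `inner_sandwich` evaluates the compression, and both are linear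
in `A`, so rank-one `A` suffice. -/

theorem measure_apply (v : 𝓗) {S : Set ℝ} (hS : MeasurableSet S) :
    E.measure v S = ENNReal.ofReal (‖E.proj S v‖ ^ 2) :=
  Measure.ofMeasurable_apply S hS

theorem measure_univ (v : 𝓗) : E.measure v Set.univ = ENNReal.ofReal (‖v‖ ^ 2) := by
  rw [E.measure_apply v MeasurableSet.univ, E.proj_univ]
  rfl

instance isFiniteMeasure_measure (v : 𝓗) : IsFiniteMeasure (E.measure v) :=
  ⟨by rw [E.measure_univ]; exact ENNReal.ofReal_lt_top⟩

theorem measureReal_apply (v : 𝓗) {S : Set ℝ} (hS : MeasurableSet S) :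
    (E.measure v).real S = ‖E.proj S v‖ ^ 2 := by
  rw [measureReal_def, E.measure_apply v hS, ENNReal.toReal_ofReal (by positivity)]

theorem measureReal_univ (v : 𝓗) : (E.measure v).real Set.univ = ‖v‖ ^ 2 := by
  rw [measureReal_def, E.measure_univ, ENNReal.toReal_ofReal (by positivity)]

theorem inner_proj_eq_measureReal (v : 𝓗) {S : Set ℝ} (hS : MeasurableSet S) :
    ⟪v, E.proj S v⟫_ℂ = ((E.measure v).real S : ℂ) := by
  have h := E.isStarProjection_proj S hS
  have hs := h.isSelfAdjoint
  rw [ContinuousLinearMap.isSelfAdjoint_iff_isSymmetric] at hs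
  rw [E.measureReal_apply v hS, ← E.inner_proj S hS v]
  refine (Complex.conj_eq_iff_re.mp ?_).symm
  rw [inner_conj_symm]
  exact hs v v

/-- Polarization writes four times a matrix element between unit vectors as a sum of four diagonal
terms. By the parallelogram law their bounds add up to `8 * C`, hence the factor 2. -/
theorem norm_le_of_inner_self_le {T : 𝓗 →L[ℂ] 𝓗} {C : ℝ} (hC : 0 ≤ C)
    (h : ∀ v, ‖⟪v, T v⟫_ℂ‖ ≤ C * ‖v‖ ^ 2) : ‖T‖ ≤ 2 * C := by
  refine ContinuousLinearMap.opNorm_le_of_re_inner_le (by positivity) fun x y hx hy => ?_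
  refine (Complex.re_le_norm _).trans ?_
  have h' (v : 𝓗) : ‖⟪(T : 𝓗 →ₗ[ℂ] 𝓗) v, v⟫_ℂ‖ ≤ C * ‖v‖ ^ 2 := by
    rw [norm_inner_symm]
    exact h v
  have hp := inner_map_polarization' (T : 𝓗 →ₗ[ℂ] 𝓗) x y
  rw [ContinuousLinearMap.coe_coe] at hp
  rw [hp, norm_div, RCLike.norm_ofNat, div_le_iff₀ (by norm_num)]
  have p1 := parallelogram_law_with_norm ℂ x y
  have p2 := parallelogram_law_with_norm ℂ x (Complex.I • y)
  simp only [norm_smul, Complex.norm_I, one_mul, hx, hy] at p1 p2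
  refine (norm_add_le _ _).trans ?_
  grw [norm_sub_le, norm_sub_le]
  simp only [norm_mul, Complex.norm_I, one_mul]
  have h1 := h' (x + y)
  have h2 := h' (x - y)
  have h3 := h' (x + Complex.I • y)
  have h4 := h' (x - Complex.I • y)
  simp only [ContinuousLinearMap.coe_coe] at h1 h2 h3 h4 ⊢
  nlinarith

theorem integrable_of_bounded (v : 𝓗) {g : ℝ → ℂ} (hg : Measurable g) {M : ℝ}
    (hM : ∀ x, ‖g x‖ ≤ M) : Integrable g (E.measure v) :=
  Integrable.of_bound hg.aestronglyMeasurable M (ae_of_all _ hM)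

theorem exists_op_simpleFunc (f : SimpleFunc ℝ ℂ) :
    ∃ T : 𝓗 →L[ℂ] 𝓗, ∀ v, ⟪v, T v⟫_ℂ = ∫ x, f x ∂(E.measure v) := by
  induction f using SimpleFunc.induction with
  | const c hs =>
    rename_i s
    refine ⟨c • E.proj s, fun v => ?_⟩
    have hf : ∀ x, (SimpleFunc.piecewise s hs (SimpleFunc.const ℝ c) (SimpleFunc.const ℝ 0)) x =
        s.indicator (fun _ => c) x := fun x => by
      simp [Set.piecewise, Set.indicator]
    simp_rw [hf]
    rw [integral_indicator hs]
    rw [setIntegral_const]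
    rw [smul_apply, inner_smul_right, E.inner_proj_eq_measureReal v hs,
      Complex.real_smul, mul_comm]
  | add _ hf hg =>
    rename_i f g _
    obtain ⟨T, hT⟩ := hf
    obtain ⟨T', hT'⟩ := hg
    refine ⟨T + T', fun v => ?_⟩
    simp only [SimpleFunc.coe_add, Pi.add_apply]
    rw [integral_add (SimpleFunc.integrable_of_isFiniteMeasure _)
      (SimpleFunc.integrable_of_isFiniteMeasure _), add_apply,
      inner_add_right, hT, hT']

theorem exists_simpleFunc_near {g : ℝ → ℂ} (hg : Measurable g) {M : ℝ} (hM : ∀ x, ‖g x‖ ≤ M)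
    (n : ℕ) : ∃ f : SimpleFunc ℝ ℂ, ∀ x, ‖f x - g x‖ ≤ 2 / (n + 1) := by
  let q : ℝ := n + 1
  have hq : 0 < q := by positivity
  -- Real and imaginary parts are rounded down to the grid of mesh `1 / (n + 1)`; boundedness of `g`
  -- leaves finitely many grid points.
  let F : SimpleFunc ℝ (ℤ × ℤ) :=
    { toFun := fun x => (⌊q * (g x).re⌋, ⌊q * (g x).im⌋)
      measurableSet_fiber' := fun y => by
        have hm : Measurable fun x => (⌊q * (g x).re⌋, ⌊q * (g x).im⌋) := by fun_prop
        exact hm (measurableSet_singleton y)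
      finite_range' := by
        refine (Set.finite_Icc ((⌊-(q * M)⌋, ⌊-(q * M)⌋) : ℤ × ℤ) (⌊q * M⌋, ⌊q * M⌋)).subset ?_
        rintro _ ⟨x, rfl⟩
        have h1 := abs_le.mp ((Complex.abs_re_le_norm _).trans (hM x))
        have h2 := abs_le.mp ((Complex.abs_im_le_norm _).trans (hM x))
        refine ⟨⟨?_, ?_⟩, ⟨?_, ?_⟩⟩ <;> apply Int.floor_mono <;> nlinarith }
  refine ⟨F.map fun p => ((p.1 / q : ℝ) : ℂ) + ((p.2 / q : ℝ) : ℂ) * Complex.I, fun x => ?_⟩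
  have key (y : ℝ) : |(⌊q * y⌋ : ℝ) / q - y| ≤ 1 / q := by
    have e : (⌊q * y⌋ : ℝ) / q - y = -(Int.fract (q * y) / q) := by
      rw [← Int.self_sub_floor]; field_simp; ring
    rw [e, abs_neg, abs_of_nonneg (div_nonneg (Int.fract_nonneg _) hq.le)]
    gcongr
    exact (Int.fract_lt_one _).le
  refine (Complex.norm_le_abs_re_add_abs_im _).trans ?_
  simp only [SimpleFunc.map_apply]
  change |((((⌊q * (g x).re⌋ / q : ℝ) : ℂ) + ((⌊q * (g x).im⌋ / q : ℝ) : ℂ) * Complex.I) - g x).re| +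
    |((((⌊q * (g x).re⌋ / q : ℝ) : ℂ) + ((⌊q * (g x).im⌋ / q : ℝ) : ℂ) * Complex.I) - g x).im| ≤ 2 / q
  simp only [Complex.sub_re, Complex.add_re, Complex.ofReal_re, Complex.re_ofReal_mul, Complex.I_re,
    mul_zero, add_zero, Complex.sub_im, Complex.add_im, Complex.ofReal_im, Complex.im_ofReal_mul,
    Complex.I_im, mul_one, zero_add]
  have := key (g x).re
  have := key (g x).im
  have e2 : (2 : ℝ) / q = 1 / q + 1 / q := by ring
  linarith

theorem norm_integral_le (v : 𝓗) {h : ℝ → ℂ} {C : ℝ} (hC : ∀ x, ‖h x‖ ≤ C) :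
    ‖∫ x, h x ∂(E.measure v)‖ ≤ C * ‖v‖ ^ 2 := by
  rw [← E.measureReal_univ v]
  exact norm_integral_le_of_norm_le_const (ae_of_all _ hC)

/-- Uniform approximation by simple functions makes the quadratic forms uniformly close, and
`norm_le_of_inner_self_le` turns this into norm convergence of the operators. This excludes the
default value `0` in the definition of `fn`. -/
theorem exists_op {g : ℝ → ℂ} (hg : Measurable g) {M : ℝ} (hM : ∀ x, ‖g x‖ ≤ M) :
    ∃ T : 𝓗 →L[ℂ] 𝓗, ∀ v, ⟪v, T v⟫_ℂ = ∫ x, g x ∂(E.measure v) := by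
  choose f hf using exists_simpleFunc_near hg hM
  choose T hT using fun n => E.exists_op_simpleFunc (f n)
  have hlim : Tendsto (fun n : ℕ => 2 / ((n : ℝ) + 1)) atTop (𝓝 0) := by
    simpa [div_eq_mul_inv] using (tendsto_one_div_add_atTop_nhds_zero_nat (𝕜 := ℝ)).const_mul 2
  have hdiff (n m : ℕ) : ‖T n - T m‖ ≤ 2 * (2 / ((n : ℝ) + 1) + 2 / ((m : ℝ) + 1)) := by
    refine norm_le_of_inner_self_le (by positivity) fun v => ?_
    rw [sub_apply, inner_sub_right, hT, hT,
      ← integral_sub (SimpleFunc.integrable_of_isFiniteMeasure _)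
        (SimpleFunc.integrable_of_isFiniteMeasure _)]
    refine E.norm_integral_le v fun x => ?_
    rw [← sub_sub_sub_cancel_right _ _ (g x)]
    exact (norm_sub_le _ _).trans (add_le_add (hf n x) (hf m x))
  have hcau : CauchySeq T := by
    refine cauchySeq_of_le_tendsto_0 (fun n : ℕ => 8 / ((n : ℝ) + 1)) (fun n m N hn hm => ?_) ?_
    · rw [dist_eq_norm]
      refine (hdiff n m).trans ?_
      have h1 : 2 / ((n : ℝ) + 1) ≤ 2 / ((N : ℝ) + 1) := by gcongr
      have h2 : 2 / ((m : ℝ) + 1) ≤ 2 / ((N : ℝ) + 1) := by gcongr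
      calc _ ≤ 2 * (2 / ((N : ℝ) + 1) + 2 / ((N : ℝ) + 1)) := by gcongr
        _ = _ := by ring
    · have := hlim.const_mul 4
      simp only [mul_zero] at this
      refine this.congr fun n => ?_
      ring
  obtain ⟨S, hS⟩ := cauchySeq_tendsto_of_complete hcau
  refine ⟨S, fun v => ?_⟩
  have h1 : Tendsto (fun n => ⟪v, T n v⟫_ℂ) atTop (𝓝 ⟪v, S v⟫_ℂ) := by
    have hc : Continuous fun R : 𝓗 →L[ℂ] 𝓗 => ⟪v, R v⟫_ℂ := by fun_prop
    exact (hc.tendsto S).comp hS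
  refine tendsto_nhds_unique h1 ?_
  rw [tendsto_iff_norm_sub_tendsto_zero]
  refine squeeze_zero (fun _ => norm_nonneg _) (fun n => ?_) (by simpa using hlim.mul_const (‖v‖ ^ 2))
  rw [hT, ← integral_sub (SimpleFunc.integrable_of_isFiniteMeasure _) (E.integrable_of_bounded v hg hM)]
  exact E.norm_integral_le v (hf n)

/-- The quadratic form of the functional calculus. -/
theorem inner_fn_self {g : ℝ → ℂ} (hg : Measurable g) {M : ℝ} (hM : ∀ x, ‖g x‖ ≤ M) (v : 𝓗) :
    ⟪v, E.fn g v⟫_ℂ = ∫ x, g x ∂(E.measure v) := by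
  have h := E.exists_op hg hM
  rw [fn, dif_pos h]
  exact h.choose_spec v

/-- The coefficients of the polarization identity. -/
def polCoeff : Fin 4 → ℂ := ![1 / 4, -1 / 4, Complex.I / 4, -Complex.I / 4]

/-- The vectors of the polarization identity. -/
def polVec (u w : 𝓗) : Fin 4 → 𝓗 := ![w + u, w - u, w + Complex.I • u, w - Complex.I • u]

/-- The complex measure `(u | E(·) w)`, applied to the function `g`. -/
def pairing (u w : 𝓗) (g : ℝ → ℂ) : ℂ :=
  ∑ k, polCoeff k * ∫ x, g x ∂(E.measure (polVec u w k))

/-- Polarization replaces the complex measure `(u | E(·) w)` by a combination of four positive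
finite measures; all measure theory below is done on such combinations. -/
theorem inner_eq_sum_polVec (T : 𝓗 →L[ℂ] 𝓗) (u w : 𝓗) :
    ⟪u, T w⟫_ℂ = ∑ k, polCoeff k * ⟪polVec u w k, T (polVec u w k)⟫_ℂ := by
  simp only [polCoeff, polVec, Fin.sum_univ_four, Matrix.cons_val_zero, Matrix.cons_val_one,
    Matrix.cons_val]
  simp only [map_add, map_sub, inner_add_left, inner_add_right, map_smul, inner_smul_left,
    inner_smul_right, Complex.conj_I, inner_sub_left, inner_sub_right]
  linear_combination (⟪u, T w⟫_ℂ / 2 - ⟪w, T u⟫_ℂ / 2) * Complex.I_sq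

theorem inner_fn {g : ℝ → ℂ} (hg : Measurable g) {M : ℝ} (hM : ∀ x, ‖g x‖ ≤ M) (u w : 𝓗) :
    ⟪u, E.fn g w⟫_ℂ = E.pairing u w g := by
  rw [inner_eq_sum_polVec, pairing]
  simp_rw [E.inner_fn_self hg hM]

theorem measure_smul (c : ℂ) (v : 𝓗) : E.measure (c • v) = ENNReal.ofReal (‖c‖ ^ 2) • E.measure v := by
  ext S hS
  rw [Measure.smul_apply, E.measure_apply _ hS, E.measure_apply _ hS, map_smul, norm_smul, mul_pow,
    ENNReal.ofReal_mul (by positivity), smul_eq_mul]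

/-- Follows from the parallelogram law in the range of each spectral projection. It carries
integrability of `e^{-βx}` from `u` and `w` to the polarization vectors. -/
theorem measure_add_le (u w : 𝓗) :
    E.measure (u + w) ≤ ENNReal.ofReal 2 • (E.measure u + E.measure w) := by
  refine Measure.le_iff.mpr fun S hS => ?_
  rw [Measure.smul_apply, Measure.add_apply, E.measure_apply _ hS, E.measure_apply _ hS,
    E.measure_apply _ hS, ← ENNReal.ofReal_add (by positivity) (by positivity), smul_eq_mul,
    ← ENNReal.ofReal_mul (by positivity), map_add]
  refine ENNReal.ofReal_le_ofReal ?_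
  have := parallelogram_law_with_norm ℂ (E.proj S u) (E.proj S w)
  nlinarith [norm_nonneg (E.proj S u - E.proj S w)]

theorem integrable_measure_add {g : ℝ → ℝ} {u w : 𝓗} (hu : Integrable g (E.measure u))
    (hw : Integrable g (E.measure w)) : Integrable g (E.measure (u + w)) :=
  ((hu.add_measure hw).smul_measure ENNReal.ofReal_ne_top).mono_measure (E.measure_add_le u w)

theorem integrable_measure_smul {g : ℝ → ℝ} {u : 𝓗} (hu : Integrable g (E.measure u)) (c : ℂ) :
    Integrable g (E.measure (c • u)) := by
  rw [E.measure_smul]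
  exact hu.smul_measure ENNReal.ofReal_ne_top

theorem integrable_measure_polVec {g : ℝ → ℝ} {u w : 𝓗} (hu : Integrable g (E.measure u))
    (hw : Integrable g (E.measure w)) (k : Fin 4) : Integrable g (E.measure (polVec u w k)) := by
  have h (c : ℂ) : Integrable g (E.measure (w + c • u)) :=
    E.integrable_measure_add hw (E.integrable_measure_smul hu c)
  fin_cases k
  · simpa [polVec] using h 1
  · simpa [polVec, sub_eq_add_neg] using h (-1)
  · simpa [polVec] using h Complex.I
  · simpa [polVec, sub_eq_add_neg] using h (-Complex.I)

end SpectralResolution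

end PauliFierz

end

noncomputable section

namespace PauliFierz

open MeasureTheory Filter Topology

/-! ## Uniqueness of complex measures -/

theorem integral_sum_smul_measure {ι : Type*} [Fintype ι] (m : ι → Measure ℝ)
    [∀ k, IsFiniteMeasure (m k)] (c : ι → ℝ) {g : ℝ → ℂ} (hg : Measurable g) {M : ℝ}
    (hM : ∀ x, ‖g x‖ ≤ M) :
    ∫ x, g x ∂(∑ k, ENNReal.ofReal (c k) • m k) = ∑ k, ((max (c k) 0 : ℝ) : ℂ) * ∫ x, g x ∂(m k) := by
  rw [integral_finsetSum_measure fun k _ =>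
    (Integrable.of_bound hg.aestronglyMeasurable M (ae_of_all _ hM)).smul_measure
      ENNReal.ofReal_ne_top]
  refine Finset.sum_congr rfl fun k _ => ?_
  rw [integral_smul_measure, ENNReal.toReal_ofReal', Complex.real_smul]

theorem isFiniteMeasure_sum_smul {ι : Type*} [Fintype ι] (m : ι → Measure ℝ)
    [∀ k, IsFiniteMeasure (m k)] (c : ι → ℝ) :
    IsFiniteMeasure (∑ k, ENNReal.ofReal (c k) • m k) := by
  refine ⟨?_⟩
  simp only [Measure.coe_finsetSum, Finset.sum_apply, Measure.smul_apply, smul_eq_mul]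
  exact ENNReal.sum_lt_top.mpr fun k _ =>
    ENNReal.mul_lt_top ENNReal.ofReal_lt_top (measure_lt_top _ _)

theorem measurable_cexp_I_mul (t : ℝ) : Measurable fun x : ℝ => Complex.exp (Complex.I * t * x) := by
  fun_prop

theorem norm_cexp_I_mul (t x : ℝ) : ‖Complex.exp (Complex.I * t * x)‖ = 1 := by
  rw [show Complex.I * t * x = ((t * x : ℝ) : ℂ) * Complex.I by push_cast; ring]
  exact Complex.norm_exp_ofReal_mul_I _

/-- With real coefficients the signed measure is a difference of two positive finite measures. Their
characteristic functions agree, so they are equal. -/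
theorem sum_integral_eq_zero_of_real {ι : Type*} [Fintype ι] (m : ι → Measure ℝ)
    [∀ k, IsFiniteMeasure (m k)] (c : ι → ℝ)
    (h : ∀ s : ℝ, ∑ k, (c k : ℂ) * ∫ x, Complex.exp (Complex.I * s * x) ∂(m k) = 0)
    {g : ℝ → ℂ} (hg : Measurable g) {M : ℝ} (hM : ∀ x, ‖g x‖ ≤ M) :
    ∑ k, (c k : ℂ) * ∫ x, g x ∂(m k) = 0 := by
  have key {g : ℝ → ℂ} (hg : Measurable g) {M : ℝ} (hM : ∀ x, ‖g x‖ ≤ M) :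
      ∑ k, (c k : ℂ) * ∫ x, g x ∂(m k) = ∫ x, g x ∂(∑ k, ENNReal.ofReal (c k) • m k) -
        ∫ x, g x ∂(∑ k, ENNReal.ofReal (-c k) • m k) := by
    rw [integral_sum_smul_measure m c hg hM, integral_sum_smul_measure m (fun k => -c k) hg hM,
      ← Finset.sum_sub_distrib]
    refine Finset.sum_congr rfl fun k _ => ?_
    rw [← sub_mul, ← Complex.ofReal_sub]
    congr 2
    rcases le_total (c k) 0 with h | h
    · rw [max_eq_right h, max_eq_left (by linarith)]; ring
    · rw [max_eq_left h, max_eq_right (by linarith)]; ring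
  have := isFiniteMeasure_sum_smul m c
  have := isFiniteMeasure_sum_smul m (fun k => -c k)
  -- `ENNReal.ofReal` truncates negative values to `0`, so the two sums carry the positive and the
  -- negative parts of the coefficients.
  have he : (∑ k, ENNReal.ofReal (c k) • m k) = ∑ k, ENNReal.ofReal (-c k) • m k := by
    refine Measure.ext_of_charFun (funext fun s => ?_)
    rw [charFun_apply_real, charFun_apply_real]
    have := key (measurable_cexp_I_mul s) (fun x => (norm_cexp_I_mul s x).le)
    rw [h s] at this
    have h2 := sub_eq_zero.mp this.symm
    simp only [show ∀ x : ℝ, (s : ℂ) * x * Complex.I = Complex.I * s * x from fun x => by ring]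
    exact h2
  rw [key hg hM, he, sub_self]

theorem sum_integral_eq_zero {ι : Type*} [Fintype ι] (m : ι → Measure ℝ)
    [∀ k, IsFiniteMeasure (m k)] (c : ι → ℂ)
    (h : ∀ s : ℝ, ∑ k, c k * ∫ x, Complex.exp (Complex.I * s * x) ∂(m k) = 0)
    {g : ℝ → ℂ} (hg : Measurable g) {M : ℝ} (hM : ∀ x, ‖g x‖ ≤ M) :
    ∑ k, c k * ∫ x, g x ∂(m k) = 0 := by
  -- Conjugating the hypothesis at `-s` gives the same identity with conjugate coefficients, so real
  -- and imaginary parts of `c` can be treated separately.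
  have hconj (s : ℝ) :
      ∑ k, starRingEnd ℂ (c k) * ∫ x, Complex.exp (Complex.I * s * x) ∂(m k) = 0 := by
    have h1 := congrArg (starRingEnd ℂ) (h (-s))
    rw [map_sum, map_zero] at h1
    rw [← h1]
    refine Finset.sum_congr rfl fun k _ => ?_
    rw [map_mul, ← integral_conj]
    congr 2
    ext x
    rw [← Complex.exp_conj]
    simp
  have hre (s : ℝ) : ∑ k, ((c k).re : ℂ) * ∫ x, Complex.exp (Complex.I * s * x) ∂(m k) = 0 := by
    simp_rw [Complex.re_eq_add_conj, div_mul_eq_mul_div, ← Finset.sum_div, add_mul,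
      Finset.sum_add_distrib]
    rw [h, hconj, add_zero, zero_div]
  have him (s : ℝ) : ∑ k, ((c k).im : ℂ) * ∫ x, Complex.exp (Complex.I * s * x) ∂(m k) = 0 := by
    simp_rw [Complex.im_eq_sub_conj, div_mul_eq_mul_div, ← Finset.sum_div, sub_mul,
      Finset.sum_sub_distrib]
    rw [h, hconj, sub_zero, zero_div]
  have h1 := sum_integral_eq_zero_of_real m _ hre hg hM
  have h2 := sum_integral_eq_zero_of_real m _ him hg hM
  calc ∑ k, c k * ∫ x, g x ∂(m k)
      = ∑ k, (((c k).re : ℂ) * ∫ x, g x ∂(m k) +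
          Complex.I * (((c k).im : ℂ) * ∫ x, g x ∂(m k))) := by
        refine Finset.sum_congr rfl fun k _ => ?_
        conv_lhs => rw [← Complex.re_add_im (c k)]
        ring
    _ = 0 := by rw [Finset.sum_add_distrib, ← Finset.mul_sum, h1, h2, mul_zero, add_zero]

theorem sum_integral_mul_eq_zero {ι : Type*} [Fintype ι] (m : ι → Measure ℝ)
    [∀ k, IsFiniteMeasure (m k)] (ρ : ι → ℝ → ℝ) (hρ : ∀ k, Measurable (ρ k))
    (hρ0 : ∀ k x, 0 ≤ ρ k x) (hρi : ∀ k, Integrable (ρ k) (m k)) (c : ι → ℂ)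
    (h : ∀ s : ℝ, ∑ k, c k * ∫ x, Complex.exp (Complex.I * s * x) * ρ k x ∂(m k) = 0)
    {g : ℝ → ℂ} (hg : Measurable g) {M : ℝ} (hM : ∀ x, ‖g x‖ ≤ M) :
    ∑ k, c k * ∫ x, g x * ρ k x ∂(m k) = 0 := by
  let m' k := (m k).withDensity fun x => ENNReal.ofReal (ρ k x)
  have (k : ι) : IsFiniteMeasure (m' k) := isFiniteMeasure_withDensity_ofReal (hρi k).2
  have hm (g : ℝ → ℂ) (k : ι) : ∫ x, g x ∂(m' k) = ∫ x, g x * ρ k x ∂(m k) := by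
    simp only [m']
    rw [integral_withDensity_eq_integral_toReal_smul (by fun_prop)
      (ae_of_all _ fun _ => ENNReal.ofReal_lt_top)]
    refine integral_congr_ae (ae_of_all _ fun x => ?_)
    simp only [ENNReal.toReal_ofReal (hρ0 k x), Complex.real_smul]
    ring
  simp_rw [← hm] at h ⊢
  exact sum_integral_eq_zero m' c h hg hM

/-! ## Functions on the strip -/

theorem closure_strip {β : ℝ} (hβ : 0 < β) :
    closure {z : ℂ | 0 < z.im ∧ z.im < β} = {z : ℂ | 0 ≤ z.im ∧ z.im ≤ β} := by
  have h1 : {z : ℂ | 0 < z.im ∧ z.im < β} = Set.univ ×ℂ Set.Ioo 0 β := by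
    ext z; simp [Complex.mem_reProdIm]
  have h2 : {z : ℂ | 0 ≤ z.im ∧ z.im ≤ β} = Set.univ ×ℂ Set.Icc 0 β := by
    ext z; simp [Complex.mem_reProdIm]
  rw [h1, h2, Complex.closure_reProdIm, closure_univ, closure_Ioo hβ.ne]

namespace IsStripContinuation

variable {β : ℝ} {g h : ℝ → ℂ} {F G : ℂ → ℂ}

theorem add (hF : IsStripContinuation β g F) (hG : IsStripContinuation β h G) :
    IsStripContinuation β (fun t => g t + h t) (fun z => F z + G z) where
  diffContOnCl := hF.diffContOnCl.add hG.diffContOnCl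
  bounded := by
    obtain ⟨M, hM⟩ := hF.bounded
    obtain ⟨N, hN⟩ := hG.bounded
    exact ⟨M + N, fun z h0 h1 => (norm_add_le _ _).trans (add_le_add (hM z h0 h1) (hN z h0 h1))⟩
  boundary t := by rw [hF.boundary, hG.boundary]

theorem mul (hF : IsStripContinuation β g F) (hG : IsStripContinuation β h G) :
    IsStripContinuation β (fun t => g t * h t) (fun z => F z * G z) where
  diffContOnCl := hF.diffContOnCl.smul hG.diffContOnCl
  bounded := by
    obtain ⟨M, hM⟩ := hF.bounded
    obtain ⟨N, hN⟩ := hG.bounded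
    refine ⟨M * N, fun z h0 h1 => ?_⟩
    rw [norm_mul]
    exact mul_le_mul (hM z h0 h1) (hN z h0 h1) (norm_nonneg _)
      ((norm_nonneg _).trans (hM z h0 h1))
  boundary t := by rw [hF.boundary, hG.boundary]

theorem const (β : ℝ) (c : ℂ) : IsStripContinuation β (fun _ => c) (fun _ => c) where
  diffContOnCl := diffContOnCl_const
  bounded := ⟨‖c‖, fun _ _ _ => le_rfl⟩
  boundary _ := rfl

theorem sum {ι : Type*} {s : Finset ι} {g : ι → ℝ → ℂ} {F : ι → ℂ → ℂ}
    (hF : ∀ i ∈ s, IsStripContinuation β (g i) (F i)) :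
    IsStripContinuation β (fun t => ∑ i ∈ s, g i t) (fun z => ∑ i ∈ s, F i z) := by
  classical
  induction s using Finset.induction_on with
  | empty => simpa using const β 0
  | insert a s ha ih =>
    simp only [Finset.sum_insert ha]
    exact (hF a (Finset.mem_insert_self _ _)).add
      (ih fun i hi => hF i (Finset.mem_insert_of_mem hi))

theorem exp (β k : ℝ) : IsStripContinuation β (fun t => Complex.exp (Complex.I * t * k))
    (fun z => Complex.exp (Complex.I * z * k)) where
  diffContOnCl := Differentiable.diffContOnCl (by fun_prop)
  bounded := by
    refine ⟨Real.exp (|k| * β), fun z h0 h1 => ?_⟩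
    rw [Complex.norm_exp]
    refine Real.exp_le_exp.mpr ?_
    simp only [Complex.mul_re, Complex.I_re, Complex.I_im, Complex.ofReal_re, Complex.ofReal_im]
    nlinarith [neg_abs_le k, abs_nonneg k]
  boundary _ := rfl

end IsStripContinuation

theorem norm_cexp_I_mul_complex (z : ℂ) (x : ℝ) :
    ‖Complex.exp (Complex.I * z * x)‖ = Real.exp (-z.im * x) := by
  rw [Complex.norm_exp]
  simp

theorem exp_neg_mul_le {β y : ℝ} (h0 : 0 ≤ y) (h1 : y ≤ β) (x : ℝ) :
    Real.exp (-y * x) ≤ 1 + Real.exp (-β * x) := by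
  rcases le_total 0 x with hx | hx
  · have : Real.exp (-y * x) ≤ 1 := Real.exp_le_one_iff.mpr (by nlinarith)
    linarith [Real.exp_pos (-β * x)]
  · have : Real.exp (-y * x) ≤ Real.exp (-β * x) := Real.exp_le_exp.mpr (by nlinarith)
    linarith

/-- On the closed strip the integrand is dominated by `1 + e^{-βx}`, which is integrable. -/
theorem isStripContinuation_integral {β : ℝ} (hβ : 0 < β) (μ : Measure ℝ) [IsFiniteMeasure μ]
    (hμ : Integrable (fun x => Real.exp (-β * x)) μ) :
    IsStripContinuation β (fun t => ∫ x, Complex.exp (Complex.I * t * x) ∂μ)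
      (fun z => ∫ x : ℝ, Complex.exp (Complex.I * z * x) ∂μ) where
  diffContOnCl := by
    have hi : Integrable (fun x => 1 + Real.exp (-β * x)) μ := (integrable_const _).add hμ
    refine ⟨?_, ?_⟩
    -- Multiplication by `i` sends the open strip into `-β < Re < 0`, where the moment generating
    -- function is holomorphic.
    · suffices h : DifferentiableOn ℂ (ProbabilityTheory.complexMGF id μ ∘ fun z => Complex.I * z)
          {z | 0 < z.im ∧ z.im < β} from h
      refine ProbabilityTheory.differentiableOn_complexMGF.comp (by fun_prop) ?_
      intro z hz
      have hsub : Set.Ioo (-β) 0 ⊆ ProbabilityTheory.integrableExpSet id μ := by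
        intro y hy
        refine hi.mono' (by fun_prop) (ae_of_all _ fun x => ?_)
        rw [Real.norm_eq_abs, Real.abs_exp]
        have := exp_neg_mul_le (β := β) (y := -y) (by linarith [hy.2]) (by linarith [hy.1]) x
        simpa using this
      refine interior_maximal hsub isOpen_Ioo ?_
      simpa using hz.symm
    · rw [closure_strip hβ]
      refine continuousOn_of_dominated (bound := fun x => 1 + Real.exp (-β * x))
        (fun z _ => by fun_prop) (fun z hz => ae_of_all _ fun x => ?_) hi
        (ae_of_all _ fun x => by fun_prop)
      rw [norm_cexp_I_mul_complex]
      exact exp_neg_mul_le hz.1 hz.2 x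
  bounded := by
    have hi : Integrable (fun x => 1 + Real.exp (-β * x)) μ := (integrable_const _).add hμ
    refine ⟨∫ x, (1 + Real.exp (-β * x)) ∂μ, fun z h0 h1 => ?_⟩
    refine norm_integral_le_of_norm_le hi (ae_of_all _ fun x => ?_)
    rw [norm_cexp_I_mul_complex]
    exact exp_neg_mul_le h0 h1 x
  boundary _ := rfl

/-- Cauchy's theorem on the rectangle with vertices `±R` and `±R + iβ`. The Gaussian bound kills the
vertical sides as `R → ∞` and makes the horizontal integrals converge. -/
theorem integral_eq_integral_add_I_mul {β : ℝ} (hβ : 0 < β) {f : ℂ → ℂ}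
    (hf : DiffContOnCl ℂ f {z | 0 < z.im ∧ z.im < β}) {C : ℝ}
    (hC : ∀ z : ℂ, 0 ≤ z.im → z.im ≤ β → ‖f z‖ ≤ C * Real.exp (-(1 / 2) * z.re ^ 2)) :
    ∫ t : ℝ, f t = ∫ t : ℝ, f (t + Complex.I * β) := by
  have hcont : ContinuousOn f {z : ℂ | 0 ≤ z.im ∧ z.im ≤ β} := closure_strip hβ ▸ hf.continuousOn
  have hgauss : Integrable fun t : ℝ => C * Real.exp (-(1 / 2) * t ^ 2) :=
    (integrable_exp_neg_mul_sq (by norm_num)).const_mul C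
  have hint (y : ℝ) (hy0 : 0 ≤ y) (hy1 : y ≤ β) :
      Integrable fun t : ℝ => f (t + y * Complex.I) := by
    refine hgauss.mono' (Continuous.aestronglyMeasurable ?_) (ae_of_all _ fun t => ?_)
    · exact hcont.comp_continuous (by fun_prop) fun t => by simp [hy0, hy1]
    · simpa using hC (t + y * Complex.I) (by simpa using hy0) (by simpa using hy1)
  have hlim (y : ℝ) (hy0 : 0 ≤ y) (hy1 : y ≤ β) :
      Tendsto (fun R : ℝ => ∫ t in (-R)..R, f (t + y * Complex.I)) atTop
        (𝓝 (∫ t : ℝ, f (t + y * Complex.I))) :=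
    intervalIntegral_tendsto_integral (hint y hy0 hy1) tendsto_neg_atTop_atBot tendsto_id
  have hdecay : Tendsto (fun R : ℝ => C * Real.exp (-(1 / 2) * R ^ 2) * |β - 0|) atTop (𝓝 0) := by
    have h1 : Tendsto (fun R : ℝ => -(1 / 2) * R ^ 2) atTop atBot :=
      (tendsto_pow_atTop two_ne_zero).const_mul_atTop_of_neg (by norm_num)
    simpa using ((Real.tendsto_exp_atBot.comp h1).const_mul C).mul_const |β - 0|
  -- The cases `σ = 1` and `σ = -1` are the right and the left side of the rectangle.
  have hvert (σ : ℝ) (hσ : σ ^ 2 = 1) :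
      Tendsto (fun R : ℝ => ∫ y in (0 : ℝ)..β, f ((σ * R : ℝ) + y * Complex.I)) atTop (𝓝 0) := by
    refine squeeze_zero_norm (fun R => ?_) hdecay
    refine intervalIntegral.norm_integral_le_of_norm_le_const fun y hy => ?_
    rw [Set.uIoc_of_le hβ.le] at hy
    have := hC ((σ * R : ℝ) + y * Complex.I) (by simpa using hy.1.le) (by simpa using hy.2)
    have e : ((σ * R : ℝ) + y * Complex.I : ℂ).re = σ * R := by simp
    rwa [e, mul_pow, hσ, one_mul] at this
  have hrect (R : ℝ) := Complex.integral_boundary_rect_eq_zero_of_continuousOn_of_differentiableOn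
    f (-R : ℝ) (R + β * Complex.I) (by
      refine hcont.mono fun z hz => ?_
      have := (Complex.mem_reProdIm.mp hz).2
      simp only [Complex.ofReal_im, Complex.add_im, Complex.mul_im, Complex.ofReal_re, Complex.I_im,
        Complex.I_re, mul_one, mul_zero, add_zero, zero_add, Set.uIcc_of_le hβ.le] at this
      exact this) (by
      refine hf.differentiableOn.mono fun z hz => ?_
      have := (Complex.mem_reProdIm.mp hz).2
      simp only [Complex.ofReal_im, Complex.add_im, Complex.mul_im, Complex.ofReal_re, Complex.I_im,
        Complex.I_re, mul_one, mul_zero, add_zero, zero_add, min_eq_left hβ.le,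
        max_eq_right hβ.le] at this
      exact this)
  have hre (R : ℝ) : ((R : ℂ) + β * Complex.I).re = R := by simp
  have him (R : ℝ) : ((R : ℂ) + β * Complex.I).im = β := by simp
  have hfin := (((hlim 0 le_rfl hβ.le).sub (hlim β hβ.le le_rfl)).add
    ((hvert 1 (by norm_num)).const_smul Complex.I)).sub
    ((hvert (-1) (by norm_num)).const_smul Complex.I)
  have hz : (fun R : ℝ => (∫ t in (-R)..R, f (t + (0 : ℝ) * Complex.I)) -
      (∫ t in (-R)..R, f (t + β * Complex.I)) +
      Complex.I • (∫ y in (0 : ℝ)..β, f ((1 * R : ℝ) + y * Complex.I)) -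
      Complex.I • (∫ y in (0 : ℝ)..β, f ((-1 * R : ℝ) + y * Complex.I))) = fun _ => 0 := by
    ext R
    have := hrect R
    simp only [hre, him, Complex.ofReal_re, Complex.ofReal_im] at this
    rw [one_mul, neg_one_mul]
    exact this
  have h0 := tendsto_nhds_unique hfin (hz ▸ tendsto_const_nhds)
  simp only [smul_zero, add_zero, sub_zero, Complex.ofReal_zero, zero_mul] at h0
  rw [sub_eq_zero.mp h0]
  simp only [mul_comm]

/-- The Gaussian `e^{-z²/2}`. -/
def gauss (z : ℂ) : ℂ := Complex.exp (-z ^ 2 / 2)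

theorem integrable_gauss (α : ℝ) : Integrable fun t : ℝ => gauss (t + Complex.I * α) := by
  have := integrable_cexp_quadratic' (b := -1 / 2) (by norm_num) (-Complex.I * α) (α ^ 2 / 2 : ℂ)
  refine this.congr (ae_of_all _ fun t => ?_)
  simp only [gauss]
  congr 1
  linear_combination ((α : ℂ) ^ 2 / 2) * Complex.I_sq

theorem integral_exp_mul_gauss (α x : ℝ) :
    ∫ t : ℝ, Complex.exp (Complex.I * t * x) * gauss (t + Complex.I * α) =
      (2 * Real.pi : ℂ) ^ (1 / 2 : ℂ) * (Real.exp (α * x - x ^ 2 / 2) : ℝ) := by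
  have h (t : ℝ) : Complex.exp (Complex.I * t * x) * gauss (t + Complex.I * α) =
      Complex.exp ((-1 / 2 : ℂ) * t ^ 2 + Complex.I * (x - α) * t + α ^ 2 / 2) := by
    rw [gauss, ← Complex.exp_add]
    congr 1
    linear_combination (-(α : ℂ) ^ 2 / 2) * Complex.I_sq
  simp_rw [h]
  rw [integral_cexp_quadratic (by norm_num), Complex.ofReal_exp]
  congr 2
  · ring
  · push_cast
    linear_combination ((x : ℂ) - α) ^ 2 / 2 * Complex.I_sq

/-- By Fubini, pairing with the Gaussian shifted by `iα` puts the weight `e^{αx - x²/2}` on `μ`. The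
translation `s` becomes the Fourier variable of the weighted measure, so varying it recovers the
whole transform. -/
theorem integral_fourier_mul_gauss (μ : Measure ℝ) [IsFiniteMeasure μ] (α s : ℝ) :
    ∫ t : ℝ, (∫ x : ℝ, Complex.exp (Complex.I * (t + s : ℝ) * x) ∂μ) * gauss (t + Complex.I * α) =
      (2 * Real.pi : ℂ) ^ (1 / 2 : ℂ) *
        ∫ x : ℝ, Complex.exp (Complex.I * s * x) * (Real.exp (α * x - x ^ 2 / 2) : ℝ) ∂μ := by
  simp_rw [← integral_mul_const]
  rw [integral_integral_swap, ← integral_const_mul]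
  · refine integral_congr_ae (ae_of_all _ fun x => ?_)
    simp only
    rw [mul_left_comm, ← integral_exp_mul_gauss, ← integral_const_mul]
    refine integral_congr_ae (ae_of_all _ fun t => ?_)
    simp only
    rw [← mul_assoc, ← Complex.exp_add]
    congr 2
    push_cast
    ring
  · have h1 : Integrable (fun p : ℝ × ℝ => gauss (p.1 + Complex.I * α) * (1 : ℂ))
        (volume.prod μ) := (integrable_gauss α).mul_prod (integrable_const (1 : ℂ))
    refine h1.mono ?_ (ae_of_all _ fun p => ?_)
    · exact Continuous.aestronglyMeasurable (by unfold gauss Function.uncurry; fun_prop)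
    · simp only [Function.uncurry, norm_mul, norm_cexp_I_mul, one_mul, mul_one, le_refl]

theorem norm_gauss_le {β : ℝ} {z : ℂ} (h0 : 0 ≤ z.im) (h1 : z.im ≤ β) :
    ‖gauss z‖ ≤ Real.exp (β ^ 2 / 2) * Real.exp (-(1 / 2) * z.re ^ 2) := by
  rw [gauss, Complex.norm_exp, ← Real.exp_add]
  refine Real.exp_le_exp.mpr ?_
  have : (-z ^ 2 / 2).re = -(z.re ^ 2 - z.im ^ 2) / 2 := by
    rw [show (2 : ℂ) = ((2 : ℝ) : ℂ) by norm_num, Complex.div_ofReal_re, Complex.neg_re, sq,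
      Complex.mul_re]
    ring
  rw [this]
  nlinarith

/-- A continuation is only bounded, so the Gaussian factor supplies the decay that the contour shift
needs. -/
theorem integral_strip_mul_gauss {β : ℝ} (hβ : 0 < β) {g : ℝ → ℂ} {F : ℂ → ℂ}
    (hF : IsStripContinuation β g F) (s : ℝ) :
    ∫ t : ℝ, g (t + s) * gauss t =
      ∫ t : ℝ, F ((t + s : ℝ) + Complex.I * β) * gauss (t + Complex.I * β) := by
  obtain ⟨M, hM⟩ := hF.bounded
  have hM0 : 0 ≤ M := (norm_nonneg _).trans (hM 0 le_rfl hβ.le)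
  have h := integral_eq_integral_add_I_mul hβ (f := fun z => F (z + s) * gauss z)
    (C := M * Real.exp (β ^ 2 / 2)) ?_ ?_
  · simp only [← hF.boundary]
    push_cast
    refine h.trans (integral_congr_ae (ae_of_all _ fun t => ?_))
    simp only
    congr 2
    ring
  · have h1 : DiffContOnCl ℂ (fun z => F (z + s)) {z | 0 < z.im ∧ z.im < β} :=
      hF.diffContOnCl.comp (f := F) (g := fun z : ℂ => z + s)
        (Differentiable.diffContOnCl (by fun_prop)) fun z hz => by simpa using hz
    have h2 : DiffContOnCl ℂ gauss {z | 0 < z.im ∧ z.im < β} :=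
      Differentiable.diffContOnCl (by unfold gauss; fun_prop)
    exact h1.smul h2
  · intro z h0 h1
    rw [norm_mul, mul_assoc]
    exact mul_le_mul (hM _ (by simpa using h0) (by simpa using h1)) (norm_gauss_le h0 h1)
      (norm_nonneg _) hM0

theorem integral_sum_fourier_mul_gauss {ι : Type*} [Fintype ι] (μ : ι → Measure ℝ)
    [∀ k, IsFiniteMeasure (μ k)] (c : ι → ℂ) (α s : ℝ) :
    ∫ t : ℝ, (∑ k, c k * ∫ x : ℝ, Complex.exp (Complex.I * (t + s : ℝ) * x) ∂(μ k)) *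
        gauss (t + Complex.I * α) =
      (2 * Real.pi : ℂ) ^ (1 / 2 : ℂ) * ∑ k, c k *
        ∫ x : ℝ, Complex.exp (Complex.I * s * x) * (Real.exp (α * x - x ^ 2 / 2) : ℝ) ∂(μ k) := by
  simp_rw [Finset.sum_mul, mul_assoc (c _)]
  rw [integral_finsetSum, Finset.mul_sum]
  · refine Finset.sum_congr rfl fun k _ => ?_
    rw [integral_const_mul, mul_left_comm, ← integral_fourier_mul_gauss]
  · intro k _
    refine Integrable.const_mul ?_ _
    refine (integrable_gauss α).bdd_mul (c := (μ k).real Set.univ) ?_ (ae_of_all _ fun t => ?_)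
    · refine Continuous.aestronglyMeasurable (continuous_of_dominated (bound := fun _ => 1)
        (fun _ => by fun_prop) (fun t => ae_of_all _ fun x => ?_) (integrable_const _)
        (ae_of_all _ fun x => by fun_prop))
      rw [norm_cexp_I_mul]
    · have := norm_integral_le_of_norm_le_const (μ := μ k) (C := 1)
        (f := fun x : ℝ => Complex.exp (Complex.I * (t + s : ℝ) * x))
        (ae_of_all _ fun x => by rw [norm_cexp_I_mul])
      simpa using this

/-- If the Fourier transform of a complex measure `μ` has a continuation to the strip, with the
Fourier transform of `ν` as its upper boundary value, then `e^{-βx} μ = ν`. -/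
theorem sum_integral_exp_mul_eq {ι κ : Type*} [Fintype ι] [Fintype κ] {β : ℝ} (hβ : 0 < β)
    (μ : ι → Measure ℝ) [∀ k, IsFiniteMeasure (μ k)] (c : ι → ℂ)
    (ν : κ → Measure ℝ) [∀ k, IsFiniteMeasure (ν k)] (d : κ → ℂ) {F : ℂ → ℂ}
    (hF : IsStripContinuation β
      (fun t => ∑ k, c k * ∫ x : ℝ, Complex.exp (Complex.I * t * x) ∂(μ k)) F)
    (hd : ∀ t : ℝ, ∑ k, d k * ∫ x : ℝ, Complex.exp (Complex.I * t * x) ∂(ν k) =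
      F (t + Complex.I * β))
    {f : ℝ → ℂ} (hf : Measurable f) {M : ℝ} (hM : ∀ x, ‖f x‖ ≤ M) (n : ℕ) :
    ∑ k, c k * ∫ x, (Set.Icc (-n : ℝ) n).indicator
        (fun x => (Real.exp (-β * x) : ℂ) * f x) x ∂(μ k) =
      ∑ k, d k * ∫ x, (Set.Icc (-n : ℝ) n).indicator f x ∂(ν k) := by
  have h2pi : (2 * Real.pi : ℂ) ^ (1 / 2 : ℂ) ≠ 0 := by
    rw [Complex.cpow_ne_zero_iff]
    left
    exact mul_ne_zero two_ne_zero (Complex.ofReal_ne_zero.mpr Real.pi_ne_zero)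
  have key (s : ℝ) :
      ∑ k, c k * ∫ x : ℝ, Complex.exp (Complex.I * s * x) *
          (Real.exp (0 * x - x ^ 2 / 2) : ℝ) ∂(μ k) =
        ∑ k, d k * ∫ x : ℝ, Complex.exp (Complex.I * s * x) *
          (Real.exp (β * x - x ^ 2 / 2) : ℝ) ∂(ν k) := by
    have h := integral_strip_mul_gauss hβ hF s
    simp only [← hd] at h
    rw [integral_sum_fourier_mul_gauss] at h
    have h0 := integral_sum_fourier_mul_gauss μ c 0 s
    simp only [Complex.ofReal_zero, mul_zero, add_zero] at h0
    rw [h0] at h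
    exact mul_left_cancel₀ h2pi h
  -- Both families are joined, the second with coefficients `-d`, so that the equality of transforms
  -- becomes one vanishing combination.
  let m : ι ⊕ κ → Measure ℝ := Sum.elim μ ν
  let ρ : ι ⊕ κ → ℝ → ℝ := Sum.elim (fun _ x => Real.exp (0 * x - x ^ 2 / 2))
    (fun _ x => Real.exp (β * x - x ^ 2 / 2))
  have : ∀ k, IsFiniteMeasure (m k) := by
    rintro (k | k)
    · exact inferInstanceAs (IsFiniteMeasure (μ k))
    · exact inferInstanceAs (IsFiniteMeasure (ν k))
  have hb (α x : ℝ) : ‖Real.exp (α * x - x ^ 2 / 2)‖ ≤ Real.exp (α ^ 2 / 2) := by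
    rw [Real.norm_eq_abs, Real.abs_exp]
    exact Real.exp_le_exp.mpr (by nlinarith [sq_nonneg (x - α)])
  obtain ⟨C, hC⟩ := isCompact_Icc.exists_bound_of_continuousOn (s := Set.Icc (-n : ℝ) n)
    (f := fun x : ℝ => (Real.exp (x ^ 2 / 2 - β * x) : ℂ)) (by fun_prop)
  have h := sum_integral_mul_eq_zero m ρ (by rintro (k | k) <;> simp only [ρ, Sum.elim_inl, Sum.elim_inr] <;> fun_prop)
    (by rintro (k | k) x <;> exact (Real.exp_pos _).le)
    (by
      rintro (k | k)
      · exact Integrable.of_bound (by simp only [ρ, Sum.elim_inl]; fun_prop) _ (ae_of_all _ (hb 0))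
      · exact Integrable.of_bound (by simp only [ρ, Sum.elim_inr]; fun_prop) _ (ae_of_all _ (hb β)))
    (Sum.elim c fun k => -d k)
    (fun s => by
      simp only [Fintype.sum_sum_type, Sum.elim_inl, Sum.elim_inr, neg_mul, Finset.sum_neg_distrib,
        m, ρ]
      rw [key s, add_neg_cancel])
    -- The exponential cancels `e^{βx - x²/2}` on the `ν` side and leaves `e^{-βx}` on the `μ` side.
    -- The cutoff keeps this test function bounded.
    (g := (Set.Icc (-n : ℝ) n).indicator fun x => (Real.exp (x ^ 2 / 2 - β * x) : ℂ) * f x)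
    (Measurable.indicator (by fun_prop) measurableSet_Icc) (M := C * M) (fun x => by
      have hM0 := (norm_nonneg _).trans (hM x)
      by_cases hx : x ∈ Set.Icc (-n : ℝ) n
      · rw [Set.indicator_of_mem hx, norm_mul]
        exact mul_le_mul (hC x hx) (hM x) (norm_nonneg _) ((norm_nonneg _).trans (hC x hx))
      · rw [Set.indicator_of_notMem hx, norm_zero]
        have h0 : (0 : ℝ) ∈ Set.Icc (-n : ℝ) n := by constructor <;> simp
        exact mul_nonneg ((norm_nonneg _).trans (hC 0 h0)) hM0)
  simp only [Fintype.sum_sum_type, Sum.elim_inl, Sum.elim_inr, neg_mul, Finset.sum_neg_distrib,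
    m, ρ, ← sub_eq_add_neg] at h
  rw [sub_eq_zero] at h
  convert! h using 6 with k _ x k _ x
  · by_cases hx : x ∈ Set.Icc (-n : ℝ) n
    · simp only [Set.indicator_of_mem hx]
      rw [mul_right_comm, ← Complex.ofReal_mul, ← Real.exp_add]
      congr 3
      ring_nf
    · simp only [Set.indicator_of_notMem hx, zero_mul]
  · by_cases hx : x ∈ Set.Icc (-n : ℝ) n
    · simp only [Set.indicator_of_mem hx]
      rw [mul_right_comm, ← Complex.ofReal_mul, ← Real.exp_add]
      simp
    · simp only [Set.indicator_of_notMem hx, zero_mul]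

theorem tendsto_integral_indicator_Icc (μ : Measure ℝ) {f : ℝ → ℂ} (hf : Integrable f μ) :
    Tendsto (fun n : ℕ => ∫ x, (Set.Icc (-n : ℝ) n).indicator f x ∂μ) atTop (𝓝 (∫ x, f x ∂μ)) := by
  refine tendsto_integral_of_dominated_convergence (fun x => ‖f x‖)
    (fun n => hf.aestronglyMeasurable.indicator measurableSet_Icc) hf.norm
    (fun n => ae_of_all _ fun x => norm_indicator_le_norm_self _ _) (ae_of_all _ fun x => ?_)
  obtain ⟨N, hN⟩ := exists_nat_ge |x|
  refine tendsto_const_nhds.congr' ?_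
  filter_upwards [eventually_ge_atTop N] with n hn
  rw [Set.indicator_of_mem]
  exact abs_le.mp (hN.trans (by exact_mod_cast hn))

end PauliFierz

end

noncomputable section

namespace PauliFierz

/-! ## Fock space up to one particle -/

section SymPow

variable {𝓗 : Type*} [NormedAddCommGroup 𝓗] [InnerProductSpace ℂ 𝓗]

theorem symmetrize_coe {n : ℕ} (x : SymPow 𝓗 n) : symmetrize 𝓗 n (x : TPow 𝓗 n) = x := by
  refine Subtype.ext ?_
  rw [coe_symmetrize, Finset.sum_congr rfl fun σ _ => x.2 σ, Finset.sum_const, Finset.card_univ,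
    Fintype.card_perm, Fintype.card_fin, ← Nat.cast_smul_eq_nsmul ℂ, smul_smul,
    inv_mul_cancel₀ (by exact_mod_cast Nat.factorial_ne_zero n), one_smul]

/-- For zero or one particle the identity is the only permutation, so symmetrization is invisible in
the part of Fock space that matters here. -/
theorem mem_symPow_of_subsingleton {n : ℕ} [Subsingleton (Fin n)] (x : TPow 𝓗 n) :
    x ∈ SymPow 𝓗 n := by
  rw [mem_symPow]
  intro σ
  rw [Subsingleton.elim σ 1]
  induction x using tpow_induction with
  | h1 c x => rw [map_smul, tperm_tpure]; rfl
  | h2 x y hx hy => rw [map_add, hx, hy]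

theorem tmap_tpure (n : ℕ) (q : 𝓗 →L[ℂ] 𝓗) (x : Fin n → 𝓗) :
    tmap 𝓗 n q (tpure 𝓗 n x) = tpure 𝓗 n fun i => q (x i) :=
  PiTensorProduct.map_tprod (R := ℂ) (s := fun _ : Fin n => 𝓗) (t := fun _ : Fin n => 𝓗)
    (fun _ => (q : 𝓗 →ₗ[ℂ] 𝓗)) x

theorem secondQuantN_zero (q : 𝓗 →L[ℂ] 𝓗) (x : SymPow 𝓗 0) : secondQuantN q 0 x = x := by
  have h (y : TPow 𝓗 0) : tmap 𝓗 0 q y = y := by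
    induction y using tpow_induction with
    | h1 c x => rw [map_smul, tmap_tpure]; congr 2; exact Subsingleton.elim _ _
    | h2 x y hx hy => rw [map_add, hx, hy]
  simp [secondQuantN, h, symmetrize_coe]

variable (𝓗) in
/-- The identification of `𝓗` with the one-particle space `⊗ₛ¹ 𝓗`. -/
def single : 𝓗 →ₗ[ℂ] SymPow 𝓗 1 where
  toFun x := ⟨tpure 𝓗 1 fun _ => x, mem_symPow_of_subsingleton _⟩
  map_add' x y := Subtype.ext (by
    have h := (tpure 𝓗 1).map_update_add (fun _ => 0) 0 x y
    have e (z : 𝓗) : Function.update (fun _ : Fin 1 => (0 : 𝓗)) 0 z = fun _ => z := by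
      ext i; rw [Subsingleton.elim i 0, Function.update_self]
    rwa [e, e, e] at h)
  map_smul' c x := Subtype.ext (by
    have h := (tpure 𝓗 1).map_update_smul (fun _ => 0) 0 c x
    have e (z : 𝓗) : Function.update (fun _ : Fin 1 => (0 : 𝓗)) 0 z = fun _ => z := by
      ext i; rw [Subsingleton.elim i 0, Function.update_self]
    rwa [e, e] at h)

theorem coe_single (x : 𝓗) : (single 𝓗 x : TPow 𝓗 1) = tpure 𝓗 1 fun _ => x := rfl

theorem coe_vacuum (y : Fin 0 → 𝓗) : (vacuum 𝓗 : TPow 𝓗 0) = tpure 𝓗 0 y := by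
  change (tpowZero 𝓗).symm 1 = _
  rw [LinearEquiv.symm_apply_eq]
  exact (PiTensorProduct.isEmptyEquiv_apply_tprod (R := ℂ) (s := fun _ : Fin 0 => 𝓗) (Fin 0) y).symm

theorem inner_vacuum_vacuum : ⟪vacuum 𝓗, vacuum 𝓗⟫_ℂ = 1 := by
  rw [Submodule.coe_inner, coe_vacuum (fun _ => 0), inner_tpure]
  simp

theorem secondQuantN_one_single (q : 𝓗 →L[ℂ] 𝓗) (x : 𝓗) :
    secondQuantN q 1 (single 𝓗 x) = single 𝓗 (q x) := by
  have h : tmap 𝓗 1 q (single 𝓗 x : TPow 𝓗 1) = single 𝓗 (q x) := tmap_tpure 1 q _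
  simp [secondQuantN, h, symmetrize_coe]

end SymPow

section OneParticle

universe u v

variable {𝒦 : Type u} [NormedAddCommGroup 𝒦] [InnerProductSpace ℂ 𝒦]
  {𝓡 : Type v} [NormedAddCommGroup 𝓡] [InnerProductSpace ℂ 𝓡]

variable (𝒦 𝓡) in
/-- The embedding of the one-particle space `𝒦 ⊗ 𝓡` into the finite-particle vectors. -/
def oneParticle : 𝒦 ⊗[ℂ] 𝓡 →ₗ[ℂ] FockDomain 𝒦 𝓡 :=
  DirectSum.lof ℂ ℕ (fun n => 𝒦 ⊗[ℂ] SymPow 𝓡 n) 1 ∘ₗ (single 𝓡).lTensor 𝒦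

theorem oneParticle_apply (x : 𝒦 ⊗[ℂ] 𝓡) : oneParticle 𝒦 𝓡 x =
    DirectSum.lof ℂ ℕ (fun n => 𝒦 ⊗[ℂ] SymPow 𝓡 n) 1 ((single 𝓡).lTensor 𝒦 x) := rfl

theorem vacuumKet_apply (k : 𝒦) : vacuumKet 𝒦 𝓡 k =
    DirectSum.lof ℂ ℕ (fun n => 𝒦 ⊗[ℂ] SymPow 𝓡 n) 0 (k ⊗ₜ vacuum 𝓡) := rfl

theorem vacuumBra_apply (Ψ : FockDomain 𝒦 𝓡) : vacuumBra 𝒦 𝓡 Ψ = TensorProduct.rid ℂ 𝒦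
    ((innerSL ℂ (vacuum 𝓡) : SymPow 𝓡 0 →ₗ[ℂ] ℂ).lTensor 𝒦 (Ψ 0)) := rfl

theorem vacuumBra_vacuumKet (k : 𝒦) : vacuumBra 𝒦 𝓡 (vacuumKet 𝒦 𝓡 k) = k := by
  rw [vacuumBra_apply, vacuumKet_apply]
  have : (DirectSum.lof ℂ ℕ (fun n => 𝒦 ⊗[ℂ] SymPow 𝓡 n) 0 (k ⊗ₜ vacuum 𝓡)) 0 = k ⊗ₜ vacuum 𝓡 :=
    DirectSum.of_eq_same _ _
  rw [this, LinearMap.lTensor_tmul, ContinuousLinearMap.coe_coe, innerSL_apply_apply,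
    inner_vacuum_vacuum, TensorProduct.rid_tmul, one_smul]

theorem absorb_zero_vacuum (x : 𝒦 ⊗[ℂ] 𝓡) :
    absorb 0 (x ⊗ₜ (vacuum 𝓡 : TPow 𝓡 0)) =
      (SymPow 𝓡 1).subtype.lTensor 𝒦 ((single 𝓡).lTensor 𝒦 x) := by
  induction x using TensorProduct.induction_on with
  | zero => simp
  | add x y hx hy => rw [TensorProduct.add_tmul, map_add, hx, hy, map_add, map_add]
  | tmul k r =>
    simp only [absorb, LinearMap.comp_apply, LinearEquiv.coe_coe, TensorProduct.assoc_tmul,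
      LinearMap.lTensor_tmul]
    congr 1
    rw [coe_vacuum (fun _ => 0)]
    refine (tpowCons_tmul_tpure 𝓡 0 r _).trans ?_
    rw [Submodule.subtype_apply, coe_single]
    refine congrArg (tpure 𝓡 1) (funext fun i => ?_)
    obtain rfl : i = 0 := Fin.fin_one_eq_zero i
    rfl

theorem expose_zero_single (x : 𝒦 ⊗[ℂ] 𝓡) :
    expose 0 ((SymPow 𝓡 1).subtype.lTensor 𝒦 ((single 𝓡).lTensor 𝒦 x)) =
      x ⊗ₜ (vacuum 𝓡 : TPow 𝓡 0) := by
  rw [← absorb_zero_vacuum]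
  simp only [expose, absorb, LinearMap.comp_apply, LinearEquiv.coe_coe]
  rw [← LinearMap.comp_apply, ← LinearMap.lTensor_comp]
  simp

theorem symmetrize_lTensor_subtype {n : ℕ} (x : 𝒦 ⊗[ℂ] SymPow 𝓡 n) :
    (symmetrize 𝓡 n).lTensor 𝒦 ((SymPow 𝓡 n).subtype.lTensor 𝒦 x) = x := by
  rw [← LinearMap.comp_apply, ← LinearMap.lTensor_comp]
  have : symmetrize 𝓡 n ∘ₗ (SymPow 𝓡 n).subtype = LinearMap.id :=
    LinearMap.ext fun y => symmetrize_coe y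
  rw [this, LinearMap.lTensor_id, LinearMap.id_apply]

theorem small_oneParticle (D : 𝒦 →L[ℂ] 𝒦) (x : 𝒦 ⊗[ℂ] 𝓡) :
    small D (oneParticle 𝒦 𝓡 x) = oneParticle 𝒦 𝓡 ((D : 𝒦 →ₗ[ℂ] 𝒦).rTensor 𝓡 x) := by
  rw [small, oneParticle_apply, DirectSum.lmap_lof, oneParticle_apply]
  congr 1
  rw [← LinearMap.comp_apply, ← LinearMap.comp_apply, LinearMap.rTensor_comp_lTensor,
    LinearMap.lTensor_comp_rTensor]

theorem small_vacuumKet (D : 𝒦 →L[ℂ] 𝒦) (k : 𝒦) :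
    small D (vacuumKet 𝒦 𝓡 k) = vacuumKet 𝒦 𝓡 (D k) := by
  rw [small, vacuumKet_apply, DirectSum.lmap_lof, vacuumKet_apply]
  rfl

theorem vacuumBra_small (D : 𝒦 →L[ℂ] 𝒦) (Ψ : FockDomain 𝒦 𝓡) :
    vacuumBra 𝒦 𝓡 (small D Ψ) = D (vacuumBra 𝒦 𝓡 Ψ) := by
  rw [vacuumBra_apply, vacuumBra_apply, small, DirectSum.lmap_apply]
  generalize Ψ 0 = x
  induction x using TensorProduct.induction_on with
  | zero => simp
  | add x y hx hy => simp only [map_add, hx, hy]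
  | tmul k r => simp

variable [FiniteDimensional ℂ 𝒦] [CompleteSpace 𝒦] [CompleteSpace 𝓡]

theorem creation_vacuumKet (V : 𝒦 →L[ℂ] 𝒦 ⊗[ℂ] 𝓡) (k : 𝒦) :
    creation V (vacuumKet 𝒦 𝓡 k) = oneParticle 𝒦 𝓡 (V k) := by
  rw [creation, vacuumKet_apply, DirectSum.toModule_lof, LinearMap.comp_apply, oneParticle_apply]
  congr 1
  simp only [creationN, LinearMap.smul_apply, LinearMap.comp_apply, LinearMap.lTensor_tmul,
    LinearMap.rTensor_tmul, Submodule.subtype_apply, ContinuousLinearMap.coe_coe]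
  rw [absorb_zero_vacuum, symmetrize_lTensor_subtype]
  simp

theorem annihilation_vacuumKet (V : 𝒦 →L[ℂ] 𝒦 ⊗[ℂ] 𝓡) (k : 𝒦) :
    annihilation V (vacuumKet 𝒦 𝓡 k) = 0 := by
  rw [annihilation, vacuumKet_apply, DirectSum.toModule_lof]
  rfl

theorem annihilation_oneParticle (V : 𝒦 →L[ℂ] 𝒦 ⊗[ℂ] 𝓡) (x : 𝒦 ⊗[ℂ] 𝓡) :
    annihilation V (oneParticle 𝒦 𝓡 x) =
      vacuumKet 𝒦 𝓡 (ContinuousLinearMap.adjoint V x) := by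
  rw [annihilation, oneParticle_apply, DirectSum.toModule_lof, vacuumKet_apply]
  simp only [LinearMap.comp_apply]
  congr 1
  simp only [annihilationN, LinearMap.smul_apply, LinearMap.comp_apply]
  rw [expose_zero_single, LinearMap.rTensor_tmul, LinearMap.lTensor_tmul, symmetrize_coe]
  simp

theorem vacuumBra_creation (V : 𝒦 →L[ℂ] 𝒦 ⊗[ℂ] 𝓡) (Ψ : FockDomain 𝒦 𝓡) :
    vacuumBra 𝒦 𝓡 (creation V Ψ) = 0 := by
  have h : vacuumBra 𝒦 𝓡 ∘ₗ creation V = 0 := by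
    refine DirectSum.linearMap_ext ℂ fun n => LinearMap.ext fun x => ?_
    simp only [LinearMap.comp_apply, LinearMap.zero_apply]
    rw [creation, DirectSum.toModule_lof, LinearMap.comp_apply, vacuumBra_apply]
    have : (DirectSum.lof ℂ ℕ (fun n => 𝒦 ⊗[ℂ] SymPow 𝓡 n) (n + 1) (creationN V n x)) 0 = 0 :=
      DirectSum.of_eq_of_ne _ _ _ (by simp)
    rw [this]
    simp
  exact LinearMap.congr_fun h Ψ

/-- Only the creation part acts on the vacuum, with factor `√1`; in `vacuumBra_fieldOp_oneParticle`
only the annihilation part leads back to it. -/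
theorem fieldOp_vacuumKet (V : 𝒦 →L[ℂ] 𝒦 ⊗[ℂ] 𝓡) (D D' : 𝒦 →L[ℂ] 𝒦) (k : 𝒦) :
    fieldOp V D D' (vacuumKet 𝒦 𝓡 k) =
      oneParticle 𝒦 𝓡 ((D : 𝒦 →ₗ[ℂ] 𝒦).rTensor 𝓡 (V (D' k))) := by
  simp only [fieldOp, LinearMap.comp_apply, LinearMap.add_apply]
  rw [small_vacuumKet, creation_vacuumKet, annihilation_vacuumKet, add_zero, small_oneParticle]

theorem vacuumBra_fieldOp_oneParticle (V : 𝒦 →L[ℂ] 𝒦 ⊗[ℂ] 𝓡) (D D' : 𝒦 →L[ℂ] 𝒦)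
    (x : 𝒦 ⊗[ℂ] 𝓡) : vacuumBra 𝒦 𝓡 (fieldOp V D D' (oneParticle 𝒦 𝓡 x)) =
      D (ContinuousLinearMap.adjoint V ((D' : 𝒦 →ₗ[ℂ] 𝒦).rTensor 𝓡 x)) := by
  simp only [fieldOp, LinearMap.comp_apply, LinearMap.add_apply]
  rw [vacuumBra_small, map_add, vacuumBra_creation, zero_add, small_oneParticle,
    annihilation_oneParticle, vacuumBra_vacuumKet]

variable (K : 𝒦 →L[ℂ] 𝒦) (E : SpectralResolution 𝓡)

theorem freeUnitary_vacuumKet (t : ℝ) (k : 𝒦) :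
    freeUnitary K E t (vacuumKet 𝒦 𝓡 k) =
      vacuumKet 𝒦 𝓡 ((NormedSpace.exp ((Complex.I * t) • K) : 𝒦 →L[ℂ] 𝒦) k) := by
  rw [freeUnitary, vacuumKet_apply, DirectSum.lmap_lof, vacuumKet_apply, TensorProduct.map_tmul,
    secondQuantN_zero]
  rfl

theorem freeUnitary_oneParticle (t : ℝ) (x : 𝒦 ⊗[ℂ] 𝓡) :
    freeUnitary K E t (oneParticle 𝒦 𝓡 x) =
      oneParticle 𝒦 𝓡 (TensorProduct.mapL (NormedSpace.exp ((Complex.I * t) • K))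
        (E.unitaryGroup t) x) := by
  rw [freeUnitary, oneParticle_apply, DirectSum.lmap_lof, oneParticle_apply]
  congr 1
  induction x using TensorProduct.induction_on with
  | zero => simp
  | add x y hx hy => simp only [map_add, hx, hy]
  | tmul k r =>
    rw [LinearMap.lTensor_tmul, TensorProduct.map_tmul, secondQuantN_one_single]
    rfl

theorem vacuumBra_freeUnitary (t : ℝ) (Ψ : FockDomain 𝒦 𝓡) :
    vacuumBra 𝒦 𝓡 (freeUnitary K E t Ψ) =
      (NormedSpace.exp ((Complex.I * t) • K) : 𝒦 →L[ℂ] 𝒦) (vacuumBra 𝒦 𝓡 Ψ) := by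
  rw [vacuumBra_apply, vacuumBra_apply, freeUnitary, DirectSum.lmap_apply]
  generalize Ψ 0 = x
  induction x using TensorProduct.induction_on with
  | zero => simp
  | add x y hx hy => simp only [map_add, hx, hy]
  | tmul k r =>
    rw [TensorProduct.map_tmul, secondQuantN_zero]
    simp

/-- The partial operator `V* (Q ⊗ g) V` on `𝒦`. -/
def sandwich (V : 𝒦 →L[ℂ] 𝒦 ⊗[ℂ] 𝓡) (Q : 𝒦 →L[ℂ] 𝒦) (T : 𝓡 →L[ℂ] 𝓡) : 𝒦 →L[ℂ] 𝒦 :=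
  ContinuousLinearMap.adjoint V ∘L TensorProduct.mapL Q T ∘L V

theorem rTensor_mapL_rTensor (A B C : 𝒦 →L[ℂ] 𝒦) (T : 𝓡 →L[ℂ] 𝓡) (x : 𝒦 ⊗[ℂ] 𝓡) :
    (A : 𝒦 →ₗ[ℂ] 𝒦).rTensor 𝓡 (TensorProduct.mapL B T ((C : 𝒦 →ₗ[ℂ] 𝒦).rTensor 𝓡 x)) =
      TensorProduct.mapL (A ∘L B ∘L C) T x := by
  induction x using TensorProduct.induction_on with
  | zero => simp
  | add x y hx hy => simp only [map_add, hx, hy]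
  | tmul k r => simp

theorem thermalState_freeDynamics_comp (β t : ℝ) (V : 𝒦 →L[ℂ] 𝒦 ⊗[ℂ] 𝓡)
    (D₁ D₁' D₂ D₂' : 𝒦 →L[ℂ] 𝒦) :
    thermalState β K (freeDynamics K E t (fieldOp V D₁ D₁') ∘ₗ fieldOp V D₂ D₂') =
      LinearMap.trace ℂ 𝒦 ((NormedSpace.exp ((-β : ℂ) • K) ∘L NormedSpace.exp ((Complex.I * t) • K)
        ∘L D₁ ∘L sandwich V (D₁' ∘L NormedSpace.exp ((Complex.I * (-t : ℝ)) • K) ∘L D₂)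
          (E.unitaryGroup (-t)) ∘L D₂' : 𝒦 →L[ℂ] 𝒦) : 𝒦 →ₗ[ℂ] 𝒦) := by
  rw [thermalState]
  congr 1
  ext k
  simp only [freeDynamics, LinearMap.comp_apply, ContinuousLinearMap.coe_coe]
  rw [fieldOp_vacuumKet, freeUnitary_oneParticle, vacuumBra_freeUnitary,
    vacuumBra_fieldOp_oneParticle, rTensor_mapL_rTensor]
  rfl

theorem thermalState_comp_freeDynamics (β t : ℝ) (V : 𝒦 →L[ℂ] 𝒦 ⊗[ℂ] 𝓡)
    (D₁ D₁' D₂ D₂' : 𝒦 →L[ℂ] 𝒦) :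
    thermalState β K (fieldOp V D₂ D₂' ∘ₗ freeDynamics K E t (fieldOp V D₁ D₁')) =
      LinearMap.trace ℂ 𝒦 ((NormedSpace.exp ((-β : ℂ) • K) ∘L D₂ ∘L
        sandwich V (D₂' ∘L NormedSpace.exp ((Complex.I * t) • K) ∘L D₁) (E.unitaryGroup t) ∘L
          D₁' ∘L NormedSpace.exp ((Complex.I * (-t : ℝ)) • K) : 𝒦 →L[ℂ] 𝒦) : 𝒦 →ₗ[ℂ] 𝒦) := by
  rw [thermalState]
  congr 1
  ext k
  simp only [freeDynamics, LinearMap.comp_apply, ContinuousLinearMap.coe_coe]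
  rw [freeUnitary_vacuumKet, fieldOp_vacuumKet, freeUnitary_oneParticle,
    vacuumBra_fieldOp_oneParticle, rTensor_mapL_rTensor]
  rfl

end OneParticle

end PauliFierz

end

noncomputable section

namespace PauliFierz

open MeasureTheory Filter Topology InnerProductSpace

universe u v

variable {𝒦 : Type u} [NormedAddCommGroup 𝒦] [InnerProductSpace ℂ 𝒦] [FiniteDimensional ℂ 𝒦]
  [CompleteSpace 𝒦] {𝓡 : Type v} [NormedAddCommGroup 𝓡] [InnerProductSpace ℂ 𝓡] [CompleteSpace 𝓡]

/-! ## Matrix elements -/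

variable (𝓡) in
/-- The partial inner product `(φ| ⊗ 1 : 𝒦 ⊗ 𝓡 → 𝓡`. -/
def slice (φ : 𝒦) : 𝒦 ⊗[ℂ] 𝓡 →ₗ[ℂ] 𝓡 :=
  (TensorProduct.lid ℂ 𝓡).toLinearMap ∘ₗ (innerSL ℂ φ : 𝒦 →ₗ[ℂ] ℂ).rTensor 𝓡

theorem slice_tmul (φ k : 𝒦) (r : 𝓡) : slice 𝓡 φ (k ⊗ₜ r) = ⟪φ, k⟫_ℂ • r := by
  simp [slice]

theorem inner_tmul_left (φ : 𝒦) (r : 𝓡) (x : 𝒦 ⊗[ℂ] 𝓡) : ⟪φ ⊗ₜ r, x⟫_ℂ = ⟪r, slice 𝓡 φ x⟫_ℂ := by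
  induction x using TensorProduct.induction_on with
  | zero => simp
  | add x y hx hy => simp only [map_add, inner_add_right, hx, hy]
  | tmul k s => rw [slice_tmul, TensorProduct.inner_tmul, inner_smul_right]

variable {ι : Type*} [Fintype ι] (b : OrthonormalBasis ι ℂ 𝒦)

theorem sum_tmul_slice (x : 𝒦 ⊗[ℂ] 𝓡) : ∑ i, b i ⊗ₜ slice 𝓡 (b i) x = x := by
  induction x using TensorProduct.induction_on with
  | zero => simp
  | add x y hx hy => simp only [map_add, TensorProduct.tmul_add, Finset.sum_add_distrib, hx, hy]
  | tmul k r =>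
    simp_rw [slice_tmul, ← TensorProduct.smul_tmul, ← TensorProduct.sum_tmul, b.sum_repr']

theorem inner_eq_sum_slice (x y : 𝒦 ⊗[ℂ] 𝓡) :
    ⟪x, y⟫_ℂ = ∑ i, ⟪slice 𝓡 (b i) x, slice 𝓡 (b i) y⟫_ℂ := by
  conv_lhs => rw [← sum_tmul_slice b x]
  simp_rw [sum_inner, inner_tmul_left]

theorem slice_mapL (Q : 𝒦 →L[ℂ] 𝒦) (T : 𝓡 →L[ℂ] 𝓡) (φ : 𝒦) (x : 𝒦 ⊗[ℂ] 𝓡) :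
    slice 𝓡 φ (TensorProduct.mapL Q T x) = ∑ d, ⟪φ, Q (b d)⟫_ℂ • T (slice 𝓡 (b d) x) := by
  conv_lhs => rw [← sum_tmul_slice b x]
  simp_rw [map_sum, TensorProduct.mapL_tmul, slice_tmul]

/-- The components `v i j ∈ 𝓡` of the coupling, `V (b j) = ∑ i, b i ⊗ v i j`. -/
def component (V : 𝒦 →L[ℂ] 𝒦 ⊗[ℂ] 𝓡) (i j : ι) : 𝓡 := slice 𝓡 (b i) (V (b j))

theorem inner_sandwich (V : 𝒦 →L[ℂ] 𝒦 ⊗[ℂ] 𝓡) (Q : 𝒦 →L[ℂ] 𝒦) (T : 𝓡 →L[ℂ] 𝓡) (i j : ι) :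
    ⟪b i, sandwich V Q T (b j)⟫_ℂ =
      ∑ c, ∑ d, ⟪b c, Q (b d)⟫_ℂ * ⟪component b V c i, T (component b V d j)⟫_ℂ := by
  rw [sandwich, ContinuousLinearMap.comp_apply, ContinuousLinearMap.adjoint_inner_right,
    ContinuousLinearMap.comp_apply, inner_eq_sum_slice b]
  simp_rw [slice_mapL b, inner_sum, inner_smul_right]
  rfl

theorem trace_comp_sandwich (V : 𝒦 →L[ℂ] 𝒦 ⊗[ℂ] 𝓡) (P Q : 𝒦 →L[ℂ] 𝒦) (T : 𝓡 →L[ℂ] 𝓡) :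
    LinearMap.trace ℂ 𝒦 ((P ∘L sandwich V Q T : 𝒦 →L[ℂ] 𝒦) : 𝒦 →ₗ[ℂ] 𝒦) =
      ∑ i, ∑ j, ∑ c, ∑ d, ⟪b i, P (b j)⟫_ℂ * ⟪b c, Q (b d)⟫_ℂ *
        ⟪component b V c j, T (component b V d i)⟫_ℂ := by
  rw [LinearMap.trace_eq_sum_inner _ b]
  refine Finset.sum_congr rfl fun i _ => ?_
  have h : ⟪b i, P (sandwich V Q T (b i))⟫_ℂ =
      ∑ j, ⟪b i, P (b j)⟫_ℂ * ⟪b j, sandwich V Q T (b i)⟫_ℂ := by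
    conv_lhs => rw [← b.sum_repr' (sandwich V Q T (b i))]
    simp_rw [map_sum, map_smul, inner_sum, inner_smul_right, mul_comm]
  refine h.trans (Finset.sum_congr rfl fun j _ => ?_)
  rw [inner_sandwich b]
  simp_rw [Finset.mul_sum, mul_assoc]

theorem trace_continuousLinearMap_comp_comm (A B : 𝒦 →L[ℂ] 𝒦) :
    LinearMap.trace ℂ 𝒦 ((A ∘L B : 𝒦 →L[ℂ] 𝒦) : 𝒦 →ₗ[ℂ] 𝒦) =
      LinearMap.trace ℂ 𝒦 ((B ∘L A : 𝒦 →L[ℂ] 𝒦) : 𝒦 →ₗ[ℂ] 𝒦) :=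
  LinearMap.trace_comp_comm' (B : 𝒦 →ₗ[ℂ] 𝒦) (A : 𝒦 →ₗ[ℂ] 𝒦)

theorem exp_smul_apply_of_eigenvector {K : 𝒦 →L[ℂ] 𝒦} {e : 𝒦} {κ : ℂ} (h : K e = κ • e) (z : ℂ) :
    (NormedSpace.exp (z • K) : 𝒦 →L[ℂ] 𝒦) e = Complex.exp (z * κ) • e := by
  have hp (n : ℕ) : ((z • K) ^ n) e = (z * κ) ^ n • e := by
    induction n with
    | zero => simp
    | succ n ih =>
      rw [pow_succ, mul_apply_eq_comp, smul_apply, h, map_smul,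
        map_smul, ih, smul_smul, smul_smul]
      congr 1
      ring
  have h1 := (NormedSpace.exp_series_hasSum_exp' (𝕂 := ℂ) (z • K)).mapL
    (ContinuousLinearMap.apply ℂ 𝒦 e)
  have h2 := (NormedSpace.exp_series_hasSum_exp' (𝕂 := ℂ) (z * κ)).smul_const e
  rw [← Complex.exp_eq_exp_ℂ] at h2
  refine h1.unique (h2.congr_fun fun n => ?_)
  simp [hp, smul_smul]

theorem exp_comp_exp {K : 𝒦 →L[ℂ] 𝒦} {κ : ι → ℝ} (h : ∀ i, K (b i) = (κ i : ℂ) • b i) (z w : ℂ) :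
    (NormedSpace.exp (z • K) : 𝒦 →L[ℂ] 𝒦) ∘L NormedSpace.exp (w • K) =
      NormedSpace.exp ((z + w) • K) := by
  refine ContinuousLinearMap.coe_injective (b.toBasis.ext fun i => ?_)
  simp only [OrthonormalBasis.coe_toBasis, ContinuousLinearMap.coe_coe,
    ContinuousLinearMap.comp_apply]
  rw [exp_smul_apply_of_eigenvector (h i), map_smul, exp_smul_apply_of_eigenvector (h i),
    exp_smul_apply_of_eigenvector (h i), smul_smul, ← Complex.exp_add]
  congr 2
  ring

theorem inner_comp_exp_comp {K : 𝒦 →L[ℂ] 𝒦} {κ : ι → ℝ} (h : ∀ i, K (b i) = (κ i : ℂ) • b i)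
    (A B : 𝒦 →L[ℂ] 𝒦) (z : ℂ) (φ ψ : 𝒦) :
    ⟪φ, (A ∘L NormedSpace.exp (z • K) ∘L B) ψ⟫_ℂ =
      ∑ k, Complex.exp (z * κ k) * (⟪b k, B ψ⟫_ℂ * ⟪φ, A (b k)⟫_ℂ) := by
  simp only [ContinuousLinearMap.comp_apply]
  conv_lhs => rw [← b.sum_repr' (B ψ)]
  simp_rw [map_sum, map_smul, exp_smul_apply_of_eigenvector (h _), map_smul, inner_sum,
    inner_smul_right]
  refine Finset.sum_congr rfl fun k _ => ?_
  ring

/-! ## The KMS identity in components -/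

/-- The KMS identity for the components of the coupling. -/
def ComponentKMS (β : ℝ) (E : SpectralResolution 𝓡) (v : ι → ι → 𝓡) : Prop :=
  ∀ i j c d, ∃ F : ℂ → ℂ,
    IsStripContinuation β (fun t => ⟪v i d, E.unitaryGroup t (v j c)⟫_ℂ) F ∧
    ∀ t : ℝ, ⟪v c j, E.unitaryGroup (-t) (v d i)⟫_ℂ = F (t + Complex.I * β)

variable {K : 𝒦 →L[ℂ] 𝒦} {κ : ι → ℝ} (E : SpectralResolution 𝓡) (V : 𝒦 →L[ℂ] 𝒦 ⊗[ℂ] 𝓡)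

/-- The exponents are written in terms of `t + iβ` so that the first two factors are those of
`thermalState_comp_freeDynamics_eq_sum` with `t` replaced by `t + iβ`. Cyclicity of the trace makes
this possible. -/
theorem thermalState_freeDynamics_comp_eq_sum (h : ∀ i, K (b i) = (κ i : ℂ) • b i) (β t : ℝ)
    (D₁ D₁' D₂ D₂' : 𝒦 →L[ℂ] 𝒦) :
    thermalState β K (freeDynamics K E t (fieldOp V D₁ D₁') ∘ₗ fieldOp V D₂ D₂') =
      ∑ i, ∑ j, ∑ c, ∑ d,
        ⟪b i, (D₂' ∘L NormedSpace.exp ((Complex.I * (t + Complex.I * β)) • K) ∘L D₁) (b j)⟫_ℂ *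
        ⟪b c, (D₁' ∘L NormedSpace.exp ((-Complex.I * (t + Complex.I * β) - β) • K) ∘L D₂) (b d)⟫_ℂ *
        ⟪component b V c j, E.unitaryGroup (-t) (component b V d i)⟫_ℂ := by
  rw [thermalState_freeDynamics_comp, ← trace_comp_sandwich]
  have e1 : Complex.I * (t + Complex.I * β) = -β + Complex.I * t := by
    linear_combination (β : ℂ) * Complex.I_sq
  have e2 : -Complex.I * (t + Complex.I * β) - β = Complex.I * (-t : ℝ) := by
    push_cast
    linear_combination -(β : ℂ) * Complex.I_sq
  rw [e1, e2, ← exp_comp_exp b h]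
  exact trace_continuousLinearMap_comp_comm (NormedSpace.exp ((-β : ℂ) • K) ∘L
    NormedSpace.exp ((Complex.I * t) • K) ∘L D₁ ∘L sandwich V (D₁' ∘L
      NormedSpace.exp ((Complex.I * (-t : ℝ)) • K) ∘L D₂) (E.unitaryGroup (-t))) D₂'

theorem sum_comm_four (f : ι → ι → ι → ι → ℂ) :
    ∑ c, ∑ d, ∑ i, ∑ j, f c d i j = ∑ i, ∑ j, ∑ c, ∑ d, f c d i j := by
  have h1 (c : ι) : ∑ d, ∑ i, ∑ j, f c d i j = ∑ i, ∑ j, ∑ d, f c d i j := by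
    rw [Finset.sum_comm]
    exact Finset.sum_congr rfl fun i _ => Finset.sum_comm
  simp_rw [h1]
  rw [Finset.sum_comm]
  exact Finset.sum_congr rfl fun i _ => Finset.sum_comm

theorem thermalState_comp_freeDynamics_eq_sum (h : ∀ i, K (b i) = (κ i : ℂ) • b i) (β t : ℝ)
    (D₁ D₁' D₂ D₂' : 𝒦 →L[ℂ] 𝒦) :
    thermalState β K (fieldOp V D₂ D₂' ∘ₗ freeDynamics K E t (fieldOp V D₁ D₁')) =
      ∑ i, ∑ j, ∑ c, ∑ d,
        ⟪b i, (D₂' ∘L NormedSpace.exp ((Complex.I * t) • K) ∘L D₁) (b j)⟫_ℂ *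
        ⟪b c, (D₁' ∘L NormedSpace.exp ((-Complex.I * t - β) • K) ∘L D₂) (b d)⟫_ℂ *
        ⟪component b V i d, E.unitaryGroup t (component b V j c)⟫_ℂ := by
  rw [thermalState_comp_freeDynamics]
  have e : -Complex.I * t - β = Complex.I * (-t : ℝ) + -β := by
    push_cast
    ring
  rw [e, ← exp_comp_exp b h]
  refine (trace_continuousLinearMap_comp_comm (NormedSpace.exp ((-β : ℂ) • K) ∘L D₂ ∘L
      sandwich V (D₂' ∘L NormedSpace.exp ((Complex.I * t) • K) ∘L D₁) (E.unitaryGroup t))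
    (D₁' ∘L NormedSpace.exp ((Complex.I * (-t : ℝ)) • K))).trans ?_
  refine (trace_comp_sandwich b V (D₁' ∘L (NormedSpace.exp ((Complex.I * (-t : ℝ)) • K) ∘L
    NormedSpace.exp ((-β : ℂ) • K)) ∘L D₂) _ _).trans ?_
  rw [sum_comm_four]
  simp_rw [mul_comm ⟪b _, (D₁' ∘L _) (b _)⟫_ℂ]

theorem isStripContinuation_inner_exp (h : ∀ i, K (b i) = (κ i : ℂ) • b i) (β : ℝ)
    (A B : 𝒦 →L[ℂ] 𝒦) (φ ψ : 𝒦) :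
    IsStripContinuation β
      (fun t => ⟪φ, (A ∘L NormedSpace.exp ((Complex.I * t) • K) ∘L B) ψ⟫_ℂ)
      (fun z => ⟪φ, (A ∘L NormedSpace.exp ((Complex.I * z) • K) ∘L B) ψ⟫_ℂ) := by
  simp_rw [inner_comp_exp_comp b h]
  exact .sum fun k _ => (IsStripContinuation.exp β (κ k)).mul (.const β _)

theorem isStripContinuation_inner_exp_neg (h : ∀ i, K (b i) = (κ i : ℂ) • b i) (β : ℝ)
    (A B : 𝒦 →L[ℂ] 𝒦) (φ ψ : 𝒦) :
    IsStripContinuation β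
      (fun t => ⟪φ, (A ∘L NormedSpace.exp ((-Complex.I * t - β) • K) ∘L B) ψ⟫_ℂ)
      (fun z => ⟪φ, (A ∘L NormedSpace.exp ((-Complex.I * z - β) • K) ∘L B) ψ⟫_ℂ) := by
  simp_rw [inner_comp_exp_comp b h]
  refine .sum fun k _ => ?_
  have e (z : ℂ) : Complex.exp ((-Complex.I * z - β) * κ k) =
      Complex.exp (Complex.I * z * (-κ k : ℝ)) * Complex.exp (-β * κ k) := by
    rw [← Complex.exp_add]
    congr 1
    push_cast
    ring
  simp_rw [e]
  exact ((IsStripContinuation.exp β (-κ k)).mul (.const β _)).mul (.const β _)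

theorem kmsIdentity_of_componentKMS (h : ∀ i, K (b i) = (κ i : ℂ) • b i) {β : ℝ}
    (hv : ComponentKMS β E (component b V)) : KMSIdentity β K E V := by
  intro D₁ D₂ D₁' D₂'
  choose F hF hF' using hv
  refine ⟨fun z => ∑ i, ∑ j, ∑ c, ∑ d,
    ⟪b i, (D₂' ∘L NormedSpace.exp ((Complex.I * z) • K) ∘L D₁) (b j)⟫_ℂ *
    ⟪b c, (D₁' ∘L NormedSpace.exp ((-Complex.I * z - β) • K) ∘L D₂) (b d)⟫_ℂ *
    F i j c d z, ?_, fun t => ?_⟩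
  · simp_rw [thermalState_comp_freeDynamics_eq_sum b E V h]
    exact .sum fun i _ => .sum fun j _ => .sum fun c _ => .sum fun d _ =>
      ((isStripContinuation_inner_exp b h β _ _ _ _).mul
        (isStripContinuation_inner_exp_neg b h β _ _ _ _)).mul (hF i j c d)
  · simp_rw [thermalState_freeDynamics_comp_eq_sum b E V h, hF']

theorem inner_rankOne_exp_rankOne [DecidableEq ι] (h : ∀ i, K (b i) = (κ i : ℂ) • b i)
    (z : ℂ) (i j m n : ι) :
    ⟪b m, (rankOne ℂ (b i) (b i) ∘L NormedSpace.exp (z • K) ∘L rankOne ℂ (b i) (b j)) (b n)⟫_ℂ =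
      if m = i then if n = j then Complex.exp (z * κ i) else 0 else 0 := by
  simp only [ContinuousLinearMap.comp_apply, rankOne_apply, map_smul,
    exp_smul_apply_of_eigenvector (h i), inner_smul_right, b.inner_eq_ite]
  by_cases h1 : m = i <;> by_cases h2 : n = j <;> simp [h1, h2, eq_comm (a := j)]

theorem sum_ite_ite_mul [DecidableEq ι] (p q : ℂ) (f : ι → ι → ι → ι → ℂ) (i j c d : ι) :
    ∑ i', ∑ j', ∑ c', ∑ d', (if i' = i then if j' = j then p else 0 else 0) *
      (if c' = c then if d' = d then q else 0 else 0) * f i' j' c' d' = p * q * f i j c d := by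
  simp only [ite_mul, zero_mul, mul_ite, mul_zero, Finset.sum_ite_irrel, Finset.sum_ite_eq',
    Finset.sum_const_zero, Finset.mem_univ, if_true]

theorem componentKMS_of_kmsIdentity (h : ∀ i, K (b i) = (κ i : ℂ) • b i) {β : ℝ}
    (hv : KMSIdentity β K E V) : ComponentKMS β E (component b V) := by
  classical
  intro i j c d
  -- The projections onto `b i` and `b c` make the factors containing `e^{zK}` scalar multiples of
  -- `|b_i)(b_j|` and `|b_c)(b_d|`, so exactly one term of the fourfold sum survives.
  obtain ⟨F, hF, hF'⟩ := hv (rankOne ℂ (b i) (b j)) (rankOne ℂ (b c) (b d))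
    (rankOne ℂ (b c) (b c)) (rankOne ℂ (b i) (b i))
  simp_rw [thermalState_comp_freeDynamics_eq_sum b E V h, inner_rankOne_exp_rankOne b h,
    sum_ite_ite_mul _ _ (fun i j c d => ⟪component b V i d, E.unitaryGroup _ (component b V j c)⟫_ℂ)]
    at hF
  simp_rw [thermalState_freeDynamics_comp_eq_sum b E V h, inner_rankOne_exp_rankOne b h,
    sum_ite_ite_mul _ _ (fun i j c d =>
      ⟪component b V c j, E.unitaryGroup (-_) (component b V d i)⟫_ℂ)] at hF'
  -- The surviving exponential has an entire inverse, bounded on the strip, so dividing it out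
  -- preserves the continuation.
  have e (z y : ℂ) : Complex.exp (Complex.I * z * κ i) *
      Complex.exp ((-Complex.I * z - β) * κ c) * y * (Complex.exp (Complex.I * z * (κ c - κ i : ℝ)) *
        Complex.exp (β * κ c)) = y := by
    have : Complex.exp (Complex.I * z * κ i) * Complex.exp ((-Complex.I * z - β) * κ c) *
        (Complex.exp (Complex.I * z * (κ c - κ i : ℝ)) * Complex.exp (β * κ c)) = 1 := by
      rw [← Complex.exp_add, ← Complex.exp_add, ← Complex.exp_add, Complex.exp_eq_one_iff]
      refine ⟨0, ?_⟩
      push_cast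
      ring
    linear_combination y * this
  refine ⟨fun z => F z * (Complex.exp (Complex.I * z * (κ c - κ i : ℝ)) * Complex.exp (β * κ c)),
    ?_, fun t => ?_⟩
  · have := hF.mul ((IsStripContinuation.exp β (κ c - κ i)).mul (.const β (Complex.exp (β * κ c))))
    simpa only [e] using this
  · simp only
    rw [← hF', e]

end PauliFierz

end

noncomputable section

namespace PauliFierz

open MeasureTheory Filter Topology InnerProductSpace

universe u v

variable {𝒦 : Type u} [NormedAddCommGroup 𝒦] [InnerProductSpace ℂ 𝒦] [FiniteDimensional ℂ 𝒦]
  [CompleteSpace 𝒦] {𝓡 : Type v} [NormedAddCommGroup 𝓡] [InnerProductSpace ℂ 𝓡] [CompleteSpace 𝓡]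

variable {ι : Type*} [Fintype ι] (b : OrthonormalBasis ι ℂ 𝒦)

/-! ## Detailed balance -/

/-- The detailed balance condition for the spectral measures of the components. -/
def DetailedBalance (β : ℝ) (E : SpectralResolution 𝓡) (v : ι → ι → 𝓡) : Prop :=
  ∀ f : ℝ → ℂ, Measurable f → (∃ M : ℝ, ∀ x, ‖f x‖ ≤ M) → ∀ i j c d,
    Tendsto (fun n : ℕ => ⟪v i d, E.fn ((Set.Icc (-n : ℝ) n).indicator
      fun x => (Real.exp (-β * x) : ℂ) * f x) (v j c)⟫_ℂ) atTop
      (𝓝 ⟪v c j, E.fn (fun x => f (-x)) (v d i)⟫_ℂ)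

theorem exists_bound_indicator_exp_mul (β : ℝ) {f : ℝ → ℂ} {M : ℝ} (hM : ∀ x, ‖f x‖ ≤ M) (n : ℕ) :
    ∃ C : ℝ, ∀ x, ‖(Set.Icc (-n : ℝ) n).indicator (fun x => (Real.exp (-β * x) : ℂ) * f x) x‖ ≤ C := by
  obtain ⟨C, hC⟩ := isCompact_Icc.exists_bound_of_continuousOn (s := Set.Icc (-n : ℝ) n)
    (f := fun x : ℝ => (Real.exp (-β * x) : ℂ)) (by fun_prop)
  refine ⟨C * M, fun x => ?_⟩
  have hM0 := (norm_nonneg _).trans (hM x)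
  by_cases hx : x ∈ Set.Icc (-n : ℝ) n
  · rw [Set.indicator_of_mem hx, norm_mul]
    exact mul_le_mul (hC x hx) (hM x) (norm_nonneg _) ((norm_nonneg _).trans (hC x hx))
  · rw [Set.indicator_of_notMem hx, norm_zero]
    have h0 : (0 : ℝ) ∈ Set.Icc (-n : ℝ) n := by constructor <;> simp
    exact mul_nonneg ((norm_nonneg _).trans (hC 0 h0)) hM0

theorem measurable_indicator_exp_mul (β : ℝ) {f : ℝ → ℂ} (hf : Measurable f) (n : ℕ) :
    Measurable ((Set.Icc (-n : ℝ) n).indicator fun x => (Real.exp (-β * x) : ℂ) * f x) :=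
  Measurable.indicator (by fun_prop) measurableSet_Icc

theorem inner_fn_indicator (β : ℝ) (E : SpectralResolution 𝓡) {f : ℝ → ℂ} (hf : Measurable f)
    {M : ℝ} (hM : ∀ x, ‖f x‖ ≤ M) (n : ℕ) (u w : 𝓡) :
    ⟪u, E.fn ((Set.Icc (-n : ℝ) n).indicator fun x => (Real.exp (-β * x) : ℂ) * f x) w⟫_ℂ =
      E.pairing u w ((Set.Icc (-n : ℝ) n).indicator fun x => (Real.exp (-β * x) : ℂ) * f x) := by
  obtain ⟨C, hC⟩ := exists_bound_indicator_exp_mul β hM n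
  exact E.inner_fn (measurable_indicator_exp_mul β hf n) hC u w

theorem inner_unitaryGroup (E : SpectralResolution 𝓡) (t : ℝ) (u w : 𝓡) :
    ⟪u, E.unitaryGroup t w⟫_ℂ = E.pairing u w fun x => Complex.exp (Complex.I * t * x) :=
  E.inner_fn (measurable_cexp_I_mul t) (fun x => (norm_cexp_I_mul t x).le) u w

theorem detailedBalance_of_componentKMS {β : ℝ} (hβ : 0 < β) {E : SpectralResolution 𝓡}
    {v : ι → ι → 𝓡} (hv : ComponentKMS β E v) : DetailedBalance β E v := by
  intro f hf ⟨M, hM⟩ i j c d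
  obtain ⟨F, hF, hF'⟩ := hv i j c d
  simp_rw [inner_unitaryGroup] at hF hF'
  simp_rw [inner_fn_indicator β E hf hM]
  rw [E.inner_fn (by fun_prop) (fun x => hM (-x))]
  -- Reflected measures turn `f(-H_R)` into integration of `f`, and `e^{-itH_R}` into the Fourier
  -- transform at `t`.
  have hmap (k : Fin 4) (g : ℝ → ℂ) :
      ∫ x, g x ∂(E.measure (SpectralResolution.polVec (v c j) (v d i) k)).map (MeasurableEquiv.neg ℝ) =
        ∫ x, g (-x) ∂(E.measure (SpectralResolution.polVec (v c j) (v d i) k)) :=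
    integral_map_equiv (MeasurableEquiv.neg ℝ) g
  have (k : Fin 4) : IsFiniteMeasure
      ((E.measure (SpectralResolution.polVec (v c j) (v d i) k)).map (MeasurableEquiv.neg ℝ)) :=
    Measure.isFiniteMeasure_map _ _
  have key := sum_integral_exp_mul_eq hβ _ SpectralResolution.polCoeff
    (fun k => (E.measure (SpectralResolution.polVec (v c j) (v d i) k)).map (MeasurableEquiv.neg ℝ))
    SpectralResolution.polCoeff hF (fun t => by
      rw [← hF', SpectralResolution.pairing]
      simp_rw [hmap]
      push_cast
      simp_rw [mul_neg, neg_mul]) hf hM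
  -- The limit is taken on the reflected side, where `f` is bounded and the measures are finite, so
  -- integrability of `e^{-βx}` is not needed in advance.
  refine (tendsto_finsetSum Finset.univ fun k _ => (tendsto_integral_indicator_Icc
    ((E.measure (SpectralResolution.polVec (v c j) (v d i) k)).map (MeasurableEquiv.neg ℝ))
    (Integrable.of_bound hf.aestronglyMeasurable M (ae_of_all _ hM))).const_mul
      (SpectralResolution.polCoeff k)).congr' ?_ |>.trans_eq ?_
  · exact Eventually.of_forall fun n => (key n).symm
  · simp_rw [hmap]
    rfl

theorem integrable_exp_of_detailedBalance {β : ℝ} {E : SpectralResolution 𝓡}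
    {v : ι → ι → 𝓡} (hv : DetailedBalance β E v) (i j : ι) :
    Integrable (fun x => Real.exp (-β * x)) (E.measure (v i j)) := by
  -- With these indices both vectors in the cutoff expression are `v i j`, so the measure is
  -- positive; a finite limit of its cutoff integrals then forces integrability.
  have h := hv (fun _ => 1) measurable_const ⟨1, fun _ => by simp⟩ i i j j
  have hi (n : ℕ) : ⟪v i j, E.fn ((Set.Icc (-n : ℝ) n).indicator
      fun x => (Real.exp (-β * x) : ℂ) * 1) (v i j)⟫_ℂ =
      ((∫ x in Set.Icc (-n : ℝ) n, Real.exp (-β * x) ∂(E.measure (v i j)) : ℝ) : ℂ) := by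
    obtain ⟨C, hC⟩ := exists_bound_indicator_exp_mul β (f := fun _ => 1) (M := 1) (by simp) n
    rw [E.inner_fn_self (measurable_indicator_exp_mul β measurable_const n) hC,
      integral_indicator measurableSet_Icc]
    simp_rw [mul_one]
    exact integral_ofReal
  simp_rw [hi] at h
  refine (aecover_Icc (tendsto_neg_atTop_atBot.comp tendsto_natCast_atTop_atTop)
    tendsto_natCast_atTop_atTop).integrable_of_integral_tendsto_of_nonneg_ae _
    (fun n => ?_) (ae_of_all _ fun x => (Real.exp_pos _).le)
    ((Complex.continuous_re.tendsto _).comp h)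
  exact Continuous.integrableOn_Icc (by fun_prop)

theorem componentKMS_of_detailedBalance {β : ℝ} (hβ : 0 < β) {E : SpectralResolution 𝓡}
    {v : ι → ι → 𝓡} (hv : DetailedBalance β E v) : ComponentKMS β E v := by
  intro i j c d
  have hint (k : Fin 4) : Integrable (fun x => Real.exp (-β * x))
      (E.measure (SpectralResolution.polVec (v i d) (v j c) k)) :=
    E.integrable_measure_polVec (integrable_exp_of_detailedBalance hv i d)
      (integrable_exp_of_detailedBalance hv j c) k
  refine ⟨fun z => ∑ k, SpectralResolution.polCoeff k * ∫ x : ℝ, Complex.exp (Complex.I * z * x)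
    ∂(E.measure (SpectralResolution.polVec (v i d) (v j c) k)), ?_, fun t => ?_⟩
  · simp_rw [inner_unitaryGroup]
    exact .sum fun k _ => (IsStripContinuation.const β _).mul
      (isStripContinuation_integral hβ _ (hint k))
  · have hM := fun x => (norm_cexp_I_mul t x).le
    have h := hv _ (measurable_cexp_I_mul t) ⟨1, hM⟩ i j c d
    simp_rw [inner_fn_indicator β E (measurable_cexp_I_mul t) hM] at h
    have he : E.unitaryGroup (-t) = E.fn fun x => Complex.exp (Complex.I * t * (-x : ℝ)) := by
      rw [SpectralResolution.unitaryGroup]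
      congr 1
      ext x
      push_cast
      ring_nf
    rw [he]
    -- The same cutoff integrals converge, by dominated convergence, to the continuation at `t +
    -- iβ`.
    refine tendsto_nhds_unique h (tendsto_finsetSum Finset.univ fun k _ => ?_)
    have e (x : ℝ) : Complex.exp (Complex.I * (t + Complex.I * β) * x) =
        (Real.exp (-β * x) : ℂ) * Complex.exp (Complex.I * t * x) := by
      rw [Complex.ofReal_exp, ← Complex.exp_add]
      congr 1
      push_cast
      linear_combination (β : ℂ) * x * Complex.I_sq
    simp_rw [e]
    refine (tendsto_integral_indicator_Icc _ ?_).const_mul _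
    refine (hint k).mono' (by fun_prop) (ae_of_all _ fun x => ?_)
    rw [norm_mul, norm_cexp_I_mul, mul_one, Complex.norm_real, Real.norm_eq_abs, Real.abs_exp]

/-! ## Detailed balance and the thermal condition -/

variable (V : 𝒦 →L[ℂ] 𝒦 ⊗[ℂ] 𝓡)

theorem sum_inner_smul_rankOne (T : 𝒦 →L[ℂ] 𝒦) :
    ∑ i, ∑ j, ⟪b i, T (b j)⟫_ℂ • rankOne ℂ (b i) (b j) = T := by
  ext x
  simp only [sum_apply, smul_apply, rankOne_apply]
  conv_rhs => rw [← b.sum_repr' x, map_sum]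
  rw [Finset.sum_comm]
  refine Finset.sum_congr rfl fun j _ => ?_
  conv_rhs => rw [map_smul, ← b.sum_repr' (T (b j)), Finset.smul_sum]
  exact Finset.sum_congr rfl fun i _ => smul_comm _ _ _

theorem tendsto_iff_tendsto_inner {α : Type*} {l : Filter α} {S : α → 𝒦 →L[ℂ] 𝒦}
    {T : 𝒦 →L[ℂ] 𝒦} : Tendsto S l (𝓝 T) ↔
      ∀ i j, Tendsto (fun n => ⟪b i, S n (b j)⟫_ℂ) l (𝓝 ⟪b i, T (b j)⟫_ℂ) := by
  refine ⟨fun h i j => ?_, fun h => ?_⟩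
  · have hc : Continuous fun R : 𝒦 →L[ℂ] 𝒦 => ⟪b i, R (b j)⟫_ℂ := by fun_prop
    exact (hc.tendsto T).comp h
  · rw [← sum_inner_smul_rankOne b T]
    have h' := tendsto_finsetSum Finset.univ fun i _ => tendsto_finsetSum Finset.univ fun j _ =>
      (h i j).smul_const (rankOne ℂ (b i) (b j))
    simpa only [sum_inner_smul_rankOne] using h'

theorem slice_eq_sum (φ : 𝒦) (x : 𝒦 ⊗[ℂ] 𝓡) :
    slice 𝓡 φ x = ∑ i, ⟪φ, b i⟫_ℂ • slice 𝓡 (b i) x := by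
  conv_lhs => rw [← sum_tmul_slice b x]
  simp_rw [map_sum, slice_tmul]

theorem slice_mapL_one (T : 𝓡 →L[ℂ] 𝓡) (φ : 𝒦) (x : 𝒦 ⊗[ℂ] 𝓡) :
    slice 𝓡 φ (TensorProduct.mapL (1 : 𝒦 →L[ℂ] 𝒦) T x) = T (slice 𝓡 φ x) := by
  induction x using TensorProduct.induction_on with
  | zero => simp
  | add x y hx hy => simp only [map_add, hx, hy]
  | tmul k r => rw [TensorProduct.mapL_tmul, slice_tmul, slice_tmul, map_smul]; rfl

/-- Expanding `A` in the basis `b` leaves products of two inner products with `w m`, which Parseval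
sums. Hence the partial trace exists and does not depend on `w`. -/
theorem hasSum_inner_tmul (A : 𝒦 →L[ℂ] 𝒦) (T : 𝓡 →L[ℂ] 𝓡) {J : Type*} (w : HilbertBasis J ℂ 𝓡)
    (φ ψ : 𝒦) :
    HasSum (fun m => ⟪φ ⊗ₜ[ℂ] w m, (TensorProduct.mapL (1 : 𝒦 →L[ℂ] 𝒦) T ∘L V ∘L A ∘L
        ContinuousLinearMap.adjoint V) (ψ ⊗ₜ[ℂ] w m)⟫_ℂ)
      (∑ i, ∑ j, ⟪b i, A (b j)⟫_ℂ * ⟪slice 𝓡 ψ (V (b j)), T (slice 𝓡 φ (V (b i)))⟫_ℂ) := by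
  refine (hasSum_sum fun i _ => hasSum_sum fun j _ => (w.hasSum_inner_mul_inner
    (slice 𝓡 ψ (V (b j))) (T (slice 𝓡 φ (V (b i))))).mul_left ⟪b i, A (b j)⟫_ℂ).congr_fun
      fun m => ?_
  have h2 (j : ι) : ⟪b j, ContinuousLinearMap.adjoint V (ψ ⊗ₜ[ℂ] w m)⟫_ℂ =
      ⟪slice 𝓡 ψ (V (b j)), w m⟫_ℂ := by
    rw [ContinuousLinearMap.adjoint_inner_right, ← inner_conj_symm, inner_tmul_left,
      inner_conj_symm]
  simp only [ContinuousLinearMap.comp_apply]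
  set y := ContinuousLinearMap.adjoint V (ψ ⊗ₜ[ℂ] w m) with hy
  have h3 : A y = ∑ i, ∑ j, (⟪b i, A (b j)⟫_ℂ * ⟪b j, y⟫_ℂ) • b i := by
    conv_lhs => rw [← sum_inner_smul_rankOne b A]
    simp only [sum_apply, smul_apply, rankOne_apply, smul_smul]
  rw [inner_tmul_left, slice_mapL_one, h3]
  simp only [map_sum, map_smul, inner_sum, inner_smul_right, h2]
  refine Finset.sum_congr rfl fun i _ => Finset.sum_congr rfl fun j _ => ?_
  ring

theorem inner_sum_smul_rankOne (m : ι → ι → ℂ) (φ ψ : 𝒦) :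
    ⟪φ, (∑ i, ∑ j, m i j • rankOne ℂ (b i) (b j) : 𝒦 →L[ℂ] 𝒦) ψ⟫_ℂ =
      ∑ i, ∑ j, m i j * (⟪φ, b i⟫_ℂ * ⟪b j, ψ⟫_ℂ) := by
  simp only [sum_apply, smul_apply, rankOne_apply, inner_sum, inner_smul_right]
  refine Finset.sum_congr rfl fun i _ => Finset.sum_congr rfl fun j _ => ?_
  ring

theorem isThermalReservoir_of_detailedBalance {β : ℝ} {E : SpectralResolution 𝓡}
    (h : DetailedBalance β E (component b V)) : IsThermalReservoir β E V := by
  classical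
  intro f hf hM A
  let P : 𝓡 →L[ℂ] 𝓡 := E.fn fun x => f (-x)
  -- These are the values of `hasSum_inner_tmul` at `φ = b i`, `ψ = b j`.
  let m (i j : ι) : ℂ := ∑ k, ∑ l, ⟪b k, A (b l)⟫_ℂ *
    ⟪component b V j l, P (component b V i k)⟫_ℂ
  refine ⟨∑ i, ∑ j, m i j • rankOne ℂ (b i) (b j), fun J w φ ψ => ?_, ?_⟩
  · have e : ⟪φ, (∑ i, ∑ j, m i j • rankOne ℂ (b i) (b j) : 𝒦 →L[ℂ] 𝒦) ψ⟫_ℂ =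
        ∑ i, ∑ j, ⟪b i, A (b j)⟫_ℂ * ⟪slice 𝓡 ψ (V (b j)), P (slice 𝓡 φ (V (b i)))⟫_ℂ := by
      rw [inner_sum_smul_rankOne]
      simp_rw [slice_eq_sum b φ, slice_eq_sum b ψ, map_sum, map_smul, inner_sum, sum_inner,
        inner_smul_left, inner_smul_right, inner_conj_symm, m, Finset.sum_mul, Finset.mul_sum]
      rw [sum_comm_four]
      refine Finset.sum_congr rfl fun k _ => Finset.sum_congr rfl fun l _ =>
        Finset.sum_congr rfl fun i _ => Finset.sum_congr rfl fun j _ => ?_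
      simp only [component]
      ring
    rw [e]
    exact hasSum_inner_tmul b V A P w φ ψ
  · refine (tendsto_iff_tendsto_inner b).mpr fun i j => ?_
    have e : ⟪b i, (∑ i, ∑ j, m i j • rankOne ℂ (b i) (b j) : 𝒦 →L[ℂ] 𝒦) (b j)⟫_ℂ = m i j := by
      rw [inner_sum_smul_rankOne]
      simp [b.inner_eq_ite]
    rw [e]
    refine Tendsto.congr (fun n => (inner_sandwich b V A _ i j).symm) ?_
    exact tendsto_finsetSum _ fun k _ => tendsto_finsetSum _ fun l _ =>
      (h f hf hM k l j i).const_mul _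

theorem sum_inner_rankOne_mul (f : ι → ι → ℂ) (i j : ι) :
    ∑ k, ∑ l, ⟪b k, rankOne ℂ (b i) (b j) (b l)⟫_ℂ * f k l = f i j := by
  classical
  simp_rw [rankOne_apply, inner_smul_right, b.inner_eq_ite]
  simp

theorem detailedBalance_of_isThermalReservoir {β : ℝ} {E : SpectralResolution 𝓡}
    (h : IsThermalReservoir β E V) : DetailedBalance β E (component b V) := by
  intro f hf hM i j c d
  obtain ⟨T, hT, hT'⟩ := h f hf hM (rankOne ℂ (b i) (b j))
  -- One orthonormal basis suffices to identify the matrix elements of `T`.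
  obtain ⟨s, w, -⟩ := exists_hilbertBasis ℂ 𝓡
  have h1 := (hT s w (b d) (b c)).unique (hasSum_inner_tmul b V _ _ w (b d) (b c))
  rw [sum_inner_rankOne_mul b fun k l =>
    ⟪slice 𝓡 (b c) (V (b l)), E.fn (fun x => f (-x)) (slice 𝓡 (b d) (V (b k)))⟫_ℂ] at h1
  have h2 := (tendsto_iff_tendsto_inner b).mp hT' d c
  rw [h1] at h2
  refine h2.congr fun n => (inner_sandwich b V _ _ d c).trans ?_
  rw [sum_inner_rankOne_mul b fun k l => ⟪component b V k d, E.fn _ (component b V l c)⟫_ℂ]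

end PauliFierz

end

/-! ### Assembly of the equivalences in an eigenbasis of `K`. -/

theorem mainTheorem9 {𝒦 𝓡 : Type*}
    [NormedAddCommGroup 𝒦] [InnerProductSpace ℂ 𝒦] [FiniteDimensional ℂ 𝒦] [CompleteSpace 𝒦]
    [NormedAddCommGroup 𝓡] [InnerProductSpace ℂ 𝓡] [CompleteSpace 𝓡]
    (β : ℝ) (hβ : 0 < β)
    (K : 𝒦 →L[ℂ] 𝒦) (hK : IsSelfAdjoint K)
    (hK1 : LinearMap.trace ℂ 𝒦 (NormedSpace.exp ((-β : ℂ) • K) : 𝒦 →L[ℂ] 𝒦) = 1)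
    (E : PauliFierz.SpectralResolution 𝓡)
    (V : 𝒦 →L[ℂ] 𝒦 ⊗[ℂ] 𝓡) :
    PauliFierz.KMSIdentity β K E V ↔ PauliFierz.IsThermalReservoir β E V := by
  have hs := (ContinuousLinearMap.isSelfAdjoint_iff_isSymmetric).mp hK
  let b := hs.eigenvectorBasis rfl
  have hb : ∀ i, K (b i) = ((hs.eigenvalues rfl i : ℝ) : ℂ) • b i :=
    hs.apply_eigenvectorBasis rfl
  exact ⟨fun h => PauliFierz.isThermalReservoir_of_detailedBalance b V
      (PauliFierz.detailedBalance_of_componentKMS hβ (PauliFierz.componentKMS_of_kmsIdentity b E V hb h)),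
    fun h => PauliFierz.kmsIdentity_of_componentKMS b E V hb
      (PauliFierz.componentKMS_of_detailedBalance hβ
        (PauliFierz.detailedBalance_of_isThermalReservoir b V h))⟩
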